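/- Let $(\mathcal M,\mathbf g)$ be a smooth four-dimensional pseudo-Riemannian manifold of arbitrary signature with two commuting smooth Killing vector fields $\xi_{1},\xi_{2}$ such that $\mathbf g$ restricted to $\Xi=\operatorname{span}(\xi_1,\xi_2)$ is nondegenerate at every point (a $\mathrm G_2$-metric; $\mathbf g$ is allowed to have further Killing fields), and let $\Xi^\perp$ be the orthogonal distribution. Suppose that $\mathbf g$ satisfies the $\Lambda$-vacuum Einstein equations $R_{\mu\nu}-\Lambda\,\mathbf g_{\mu\nu}=0$ for some $\Lambda\in\mathbb R$. Then at every point the sectional curvatures of $\Xi$ and $\Xi^\perp$ coincide: $$K(\Xi)=K(\Xi^\perp).$$ Here $K$ of the plane spanned by $u,v$ is $\dfrac{\mathbf g(R(u,v)v,u)}{\mathbf g(u,u)\mathbf g(v,v)-\mathbf g(u,v)^2}$ with $R(X,Y)=[\nabla_X,\nabla_Y]-\nabla_{[X,Y]}$, $\nabla$ being the Levi-Civita connection. Moreover, in all local coordinates $t^1,t^2,z^1,z^2$ with $\xi_k=\partial/\partial z^k$ (adapted coordinates), write $$\mathbf g=\tilde g_{ij}\,dt^i dt^j+h_{kl}\,(dz^k+f^k_i\,dt^i)(dz^l+f^l_j\,dt^j),$$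 where all coefficients depend locally on $t^1,t^2$ only, and put $\mathbf e_i=\partial_{t^i}-f_i^k\partial_{z^k}$. Then $$K(\Xi)=K(\partial_{z^1},\partial_{z^2})=-\tfrac14 C_\chi,\qquad K(\Xi^\perp)=K(\mathbf e_1,\mathbf e_2)=\tfrac12 C_{\mathrm{ric}}-\tfrac34\,\varepsilon\,\ell_{\mathcal C},\qquad C_{\mathrm{ric}}+\tfrac12 C_\chi-\tfrac32\,\varepsilon\,\ell_{\mathcal C}=0,$$ where $\varepsilon=\operatorname{sgn}\det(\tilde g_{ij})$; $C_{\mathrm{ric}}$ is the scalar curvature of the two-dimensional metric $\tilde g_{ij}\,dt^i dt^j$; $C_\chi=\tilde g^{ij}\chi_{ij}$ with $\chi=(\det h)^{-1}(dh_{11}\,dh_{22}-dh_{12}\,dh_{12})$, a symmetric tensor; and $\ell_{\mathcal C}=h_{kl}\,\mathcal C^k\mathcal C^l$ with $\mathcal C^k=(\partial_{t^2}f^k_1-\partial_{t^1}f^k_2)/\sqrt{|\det(\tilde g_{ij})|}$. -/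

import Mathlib

open scoped Manifold ContDiff

noncomputable section

/-! ### Classical tensor calculus in coordinates

A metric on (an open subset of) `ℝⁿ` is given by its matrix of components, a function
`G : EuclideanSpace ℝ (Fin n) → Matrix (Fin n) (Fin n) ℝ`. -/

/-- The partial derivative `∂ᵢ F` at `x`. -/
def partialDeriv {n : ℕ} (i : Fin n) (F : EuclideanSpace ℝ (Fin n) → ℝ)
    (x : EuclideanSpace ℝ (Fin n)) : ℝ :=
  fderiv ℝ F x (EuclideanSpace.single i 1)

/-- The Christoffel symbol `Γᵏᵢⱼ = ½ gᵏˡ (∂ᵢ gₗⱼ + ∂ⱼ gₗᵢ - ∂ₗ gᵢⱼ)` of the Levi-Civita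
connection of `G`. -/
def christoffel {n : ℕ} (G : EuclideanSpace ℝ (Fin n) → Matrix (Fin n) (Fin n) ℝ)
    (k i j : Fin n) (x : EuclideanSpace ℝ (Fin n)) : ℝ :=
  (1 / 2) * ∑ l, (G x)⁻¹ k l *
    (partialDeriv i (fun y => G y l j) x + partialDeriv j (fun y => G y l i) x
      - partialDeriv l (fun y => G y i j) x)

/-- The component `Rˡₖᵢⱼ` of the Riemann tensor
`R(X, Y) Z = ∇_X ∇_Y Z - ∇_Y ∇_X Z - ∇_[X,Y] Z`, that is, `R(∂ᵢ, ∂ⱼ) ∂ₖ = Rˡₖᵢⱼ ∂ₗ`. -/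
def riemann {n : ℕ} (G : EuclideanSpace ℝ (Fin n) → Matrix (Fin n) (Fin n) ℝ)
    (l k i j : Fin n) (x : EuclideanSpace ℝ (Fin n)) : ℝ :=
  partialDeriv i (christoffel G l j k) x - partialDeriv j (christoffel G l i k) x
    + ∑ m, (christoffel G l i m x * christoffel G m j k x
      - christoffel G l j m x * christoffel G m i k x)

/-- The Ricci tensor `Ric(∂ⱼ, ∂ₖ) = tr (X ↦ R(X, ∂ⱼ) ∂ₖ) = Rⁱₖᵢⱼ`. -/
def ricci {n : ℕ} (G : EuclideanSpace ℝ (Fin n) → Matrix (Fin n) (Fin n) ℝ)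
    (j k : Fin n) (x : EuclideanSpace ℝ (Fin n)) : ℝ :=
  ∑ i, riemann G i k i j x

/-- The scalar curvature `gʲᵏ Ricⱼₖ`. -/
def scalarCurvature {n : ℕ} (G : EuclideanSpace ℝ (Fin n) → Matrix (Fin n) (Fin n) ℝ)
    (x : EuclideanSpace ℝ (Fin n)) : ℝ :=
  ∑ j, ∑ k, (G x)⁻¹ j k * ricci G j k x

/-- The scalar product `g(u, v)` at `x` of two vectors given by their components. -/
def coordInner {n : ℕ} (G : EuclideanSpace ℝ (Fin n) → Matrix (Fin n) (Fin n) ℝ)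
    (x u v : EuclideanSpace ℝ (Fin n)) : ℝ :=
  ∑ i, ∑ j, G x i j * u i * v j

/-- The components of the vector `R(u, v) w` at `x`. -/
def curvatureOp {n : ℕ} (G : EuclideanSpace ℝ (Fin n) → Matrix (Fin n) (Fin n) ℝ)
    (x u v w : EuclideanSpace ℝ (Fin n)) : EuclideanSpace ℝ (Fin n) :=
  WithLp.toLp 2 fun l => ∑ k, ∑ i, ∑ j, riemann G l k i j x * u i * v j * w k

/-- The sectional curvature `g(R(u, v) v, u) / (g(u, u) g(v, v) - g(u, v)²)` at `x` of the plane
spanned by `u` and `v` (positive for round spheres). -/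
def coordSectional {n : ℕ} (G : EuclideanSpace ℝ (Fin n) → Matrix (Fin n) (Fin n) ℝ)
    (x u v : EuclideanSpace ℝ (Fin n)) : ℝ :=
  coordInner G x (curvatureOp G x u v v) u /
    (coordInner G x u u * coordInner G x v v - coordInner G x u v ^ 2)

/-! ### Four-dimensional pseudo-Riemannian manifolds -/

/-- The model space of four-dimensional manifolds. In adapted coordinates the indices `0, 1`
(that is, `Fin.castAdd 2 i`) belong to `t¹, t²` and the indices `2, 3` (that is, `Fin.natAdd 2 k`)
to `z¹, z²`. -/
abbrev E4 : Type := EuclideanSpace ℝ (Fin (2 + 2))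

/-- Coordinates `t¹, t²` or `z¹, z²`. -/
abbrev E2 : Type := EuclideanSpace ℝ (Fin 2)

section Manifolds

variable {M : Type*} [TopologicalSpace M] [ChartedSpace E4 M]

/-- The tangent vector `∂/∂xᵃ` at `p` of the coordinate system `φ`. -/
def coordVector (φ : OpenPartialHomeomorph M E4) (p : M) (a : Fin (2 + 2)) :
    TangentSpace 𝓘(ℝ, E4) p :=
  (mfderiv 𝓘(ℝ, E4) 𝓘(ℝ, E4) φ p).inverse (EuclideanSpace.single a (1 : ℝ) : E4)

/-- The components in the coordinate system `φ` of a tangent vector at `p`. -/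
def coordComponents (φ : OpenPartialHomeomorph M E4) (p : M) (v : TangentSpace 𝓘(ℝ, E4) p) : E4 :=
  mfderiv 𝓘(ℝ, E4) 𝓘(ℝ, E4) φ p v

variable (M) in
/-- A smooth pseudo-Riemannian metric, of any signature, on a four-dimensional manifold. Smoothness
means that the components in every coordinate system are smooth. -/
structure PseudoRiemannianMetric where
  /-- The scalar product on each tangent space. -/
  val : ∀ p : M, LinearMap.BilinForm ℝ (TangentSpace 𝓘(ℝ, E4) p)
  symm : ∀ p u v, val p u v = val p v u
  nondegenerate : ∀ p u, (∀ v, val p u v = 0) → u = 0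
  smooth : ∀ φ ∈ IsManifold.maximalAtlas 𝓘(ℝ, E4) ∞ M, ∀ a b : Fin (2 + 2),
    ContDiffOn ℝ ∞ (fun x : E4 => val (φ.symm x) (coordVector φ (φ.symm x) a)
      (coordVector φ (φ.symm x) b)) φ.target

namespace PseudoRiemannianMetric

/-- The components `g_ab` of the metric in the coordinate system `φ`, as functions of the
coordinates; only their values on `φ.target` are meaningful. -/
def components (g : PseudoRiemannianMetric M) (φ : OpenPartialHomeomorph M E4) (x : E4) :
    Matrix (Fin (2 + 2)) (Fin (2 + 2)) ℝ :=
  Matrix.of fun a b => g.val (φ.symm x) (coordVector φ (φ.symm x) a) (coordVector φ (φ.symm x) b)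

/-- The sectional curvature of the plane spanned by `u, v ∈ T_p M`, computed in the coordinate
system `φ` around `p`. -/
def sectional (g : PseudoRiemannianMetric M) (φ : OpenPartialHomeomorph M E4) (p : M)
    (u v : TangentSpace 𝓘(ℝ, E4) p) : ℝ :=
  coordSectional (g.components φ) (φ p) (coordComponents φ p u) (coordComponents φ p v)

/-- The `Λ`-vacuum Einstein equations `R_μν - Λ g_μν = 0`. -/
def IsLambdaVacuum (g : PseudoRiemannianMetric M) (Λ : ℝ) : Prop :=
  ∀ φ ∈ IsManifold.maximalAtlas 𝓘(ℝ, E4) ∞ M, ∀ x ∈ φ.target, ∀ a b : Fin (2 + 2),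
    ricci (g.components φ) a b x - Λ * g.components φ x a b = 0

/-- `X` is a Killing vector field: in all coordinates,
`(L_X g)_ab = Xᶜ ∂_c g_ab + ∂_a Xᶜ g_cb + ∂_b Xᶜ g_ac = 0`. -/
def IsKilling (g : PseudoRiemannianMetric M) (X : ∀ p : M, TangentSpace 𝓘(ℝ, E4) p) : Prop :=
  ∀ φ ∈ IsManifold.maximalAtlas 𝓘(ℝ, E4) ∞ M, ∀ x ∈ φ.target, ∀ a b : Fin (2 + 2),
    ∑ c, (coordComponents φ (φ.symm x) (X (φ.symm x)) c
          * partialDeriv c (fun y => g.components φ y a b) x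
        + partialDeriv a (fun y => coordComponents φ (φ.symm y) (X (φ.symm y)) c) x
          * g.components φ x c b
        + partialDeriv b (fun y => coordComponents φ (φ.symm y) (X (φ.symm y)) c) x
          * g.components φ x a c) = 0

end PseudoRiemannianMetric

/-- `g` is a `G₂`-metric with respect to `ξ₁, ξ₂`: these are commuting smooth Killing vector fields,
and the restriction of `g` to their span is nondegenerate at each point (so that, in particular,
they are linearly independent at each point). -/
structure IsG2Metric [IsManifold 𝓘(ℝ, E4) ∞ M] (g : PseudoRiemannianMetric M)
    (ξ : Fin 2 → ∀ p : M, TangentSpace 𝓘(ℝ, E4) p) : Prop where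
  smooth : ∀ k, ContMDiff 𝓘(ℝ, E4) 𝓘(ℝ, E4).tangent ∞
    (fun p => (⟨p, ξ k p⟩ : TangentBundle 𝓘(ℝ, E4) M))
  killing : ∀ k, g.IsKilling (ξ k)
  commute : ∀ p, VectorField.mlieBracket 𝓘(ℝ, E4) (ξ 0) (ξ 1) p = 0
  nonnull : ∀ p, (Matrix.of fun k l => g.val p (ξ k p) (ξ l p)).det ≠ 0

/-- The Killing distribution `Ξ`, spanned by `ξ₁` and `ξ₂`. -/
def killingDistribution (ξ : Fin 2 → ∀ p : M, TangentSpace 𝓘(ℝ, E4) p) (p : M) :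
    Submodule ℝ (TangentSpace 𝓘(ℝ, E4) p) :=
  Submodule.span ℝ (Set.range fun k => ξ k p)

/-- The orthogonal distribution `Ξ^⊥`. -/
def orthogonalDistribution (g : PseudoRiemannianMetric M)
    (ξ : Fin 2 → ∀ p : M, TangentSpace 𝓘(ℝ, E4) p) (p : M) :
    Submodule ℝ (TangentSpace 𝓘(ℝ, E4) p) :=
  (g.val p).orthogonal (killingDistribution ξ p)

/-- `φ = (t¹, t², z¹, z²)` is a system of adapted coordinates: `ξ_k = ∂/∂zᵏ`. -/
def IsAdapted [IsManifold 𝓘(ℝ, E4) ∞ M] (ξ : Fin 2 → ∀ p : M, TangentSpace 𝓘(ℝ, E4) p)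
    (φ : OpenPartialHomeomorph M E4) : Prop :=
  φ ∈ IsManifold.maximalAtlas 𝓘(ℝ, E4) ∞ M ∧
    ∀ p ∈ φ.source, ∀ k : Fin 2, ξ k p = coordVector φ p (Fin.natAdd 2 k)

end Manifolds

/-! ### Invariants in adapted coordinates

Below `G` is the matrix of components of the metric in adapted coordinates,
`g = b_ij dtⁱ dtʲ + 2 f_ik dtⁱ dzᵏ + h_kl dzᵏ dzˡ`. -/

namespace Adapted

variable (G : E4 → Matrix (Fin (2 + 2)) (Fin (2 + 2)) ℝ)

/-- The matrix `(b_ij)`. -/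
def b (x : E4) : Matrix (Fin 2) (Fin 2) ℝ := (G x).submatrix (Fin.castAdd 2) (Fin.castAdd 2)

/-- The matrix `(f_ik)`. -/
def f (x : E4) : Matrix (Fin 2) (Fin 2) ℝ := (G x).submatrix (Fin.castAdd 2) (Fin.natAdd 2)

/-- The matrix `(h_kl)`. -/
def h (x : E4) : Matrix (Fin 2) (Fin 2) ℝ := (G x).submatrix (Fin.natAdd 2) (Fin.natAdd 2)

/-- The functions `f_i^k = f_is h^sk`, with row index `i` and column index `k`. -/
def fUp (x : E4) : Matrix (Fin 2) (Fin 2) ℝ := f G x * (h G x)⁻¹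

/-- The components `g̃_ij = b_ij - f_ik f_jl h^kl` of the orbit metric. -/
def orbit (x : E4) : Matrix (Fin 2) (Fin 2) ℝ := b G x - f G x * (h G x)⁻¹ * (f G x).transpose

/-- The point with coordinates `(t, z)`. -/
def join (t z : E2) : E4 := WithLp.toLp 2 (Fin.append t z)

/-- The coordinates `(t¹, t²)` of a point. -/
def tPart (x : E4) : E2 := WithLp.toLp 2 fun i => x (Fin.castAdd 2 i)

/-- The coordinates `(z¹, z²)` of a point. -/
def zPart (x : E4) : E2 := WithLp.toLp 2 fun k => x (Fin.natAdd 2 k)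

/-- `C_ric`, the scalar curvature of the orbit metric `g̃_ij dtⁱ dtʲ`. As the coefficients do not
depend on `z`, they are regarded as functions of `t` by fixing `z`. -/
def Cric (x : E4) : ℝ := scalarCurvature (fun t : E2 => orbit G (join t (zPart x))) (tPart x)

/-- The symmetric tensor `χ = (dh₁₁ dh₂₂ - dh₁₂ dh₁₂) / det h` on the orbit space. -/
def chi (x : E4) : Matrix (Fin 2) (Fin 2) ℝ :=
  Matrix.of fun i j =>
    let D : Fin 2 → Fin 2 → Fin 2 → ℝ := fun i k l =>
      partialDeriv (Fin.castAdd 2 i) (fun y => h G y k l) x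
    (D i 0 0 * D j 1 1 + D j 0 0 * D i 1 1 - 2 * (D i 0 1 * D j 0 1)) / (2 * (h G x).det)

/-- `C_χ = χ_ij g̃^ij`. -/
def Cchi (x : E4) : ℝ := ∑ i, ∑ j, chi G x i j * (orbit G x)⁻¹ i j

/-- The components `𝒞ᵏ = (∂_{t²} f₁ᵏ - ∂_{t¹} f₂ᵏ) / √|det g̃|` of the curvature vector field. -/
def curvVector (x : E4) (k : Fin 2) : ℝ :=
  (partialDeriv (Fin.castAdd 2 1) (fun y => fUp G y 0 k) x
    - partialDeriv (Fin.castAdd 2 0) (fun y => fUp G y 1 k) x) / √|(orbit G x).det|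

/-- `ℓ_𝒞 = g(𝒞, 𝒞)`. -/
def ellC (x : E4) : ℝ := ∑ k, ∑ l, h G x k l * curvVector G x k * curvVector G x l

end Adapted

/-- The horizontal vectors `e_i = ∂/∂tⁱ - f_i^k ∂/∂zᵏ`, which span `Ξ^⊥` in adapted coordinates. -/
def horizontalFrame {M : Type*} [TopologicalSpace M] [ChartedSpace E4 M]
    (g : PseudoRiemannianMetric M) (φ : OpenPartialHomeomorph M E4) (p : M) (i : Fin 2) :
    TangentSpace 𝓘(ℝ, E4) p :=
  coordVector φ p (Fin.castAdd 2 i)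
    - ∑ k, Adapted.fUp (g.components φ) (φ p) i k • coordVector φ p (Fin.natAdd 2 k)

end

/-!
At a point, the curvature of constant coordinate fields is the antisymmetrised second derivative of
the metric plus scalar products of covariant derivatives, so all curvatures can be read off the
two-jet of the metric.

In dimension four, tracing the Einstein equation over `Ξ` gives `2 K(Ξ)` plus the double trace of
the curvature over `Ξ` and `Ξ^⊥`, and tracing it over `Ξ^⊥` gives `2 K(Ξ^⊥)` plus the same double
trace. Both sums equal `2 Λ`, so `K(Ξ) = K(Ξ^⊥)`.

In adapted coordinates the orbits of the Killing fields are flat with second fundamental form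
`-dh / 2`, and Gauss' equation gives `K(Ξ) = -C_χ / 4`. For `K(Ξ^⊥)` the fields `𝐞ᵢ` are frozen to
constant fields at the point under consideration, where the quotient metric is the Schur complement
of `h`: its second derivatives differ from those of `𝐠` on the frozen fields by products of first
derivatives of the functions `𝐠(𝐞ᵢ, ∂/∂zᵏ)`, which vanish at the point. Their antisymmetric part,
the curvature of `f`, produces the O'Neill term `-3/4 ε ℓ_𝒞`.
-/

noncomputable section

/-! ### Gram matrices -/

section GramMatrix

open Module

variable {K V ι κ : Type*} [Field K] [AddCommGroup V] [Module K V]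

/-- The Gram matrix of a family of vectors with respect to a bilinear form; the family need not be
a basis. -/
def gramMatrix (B : LinearMap.BilinForm K V) (e : ι → V) : Matrix ι ι K :=
  Matrix.of fun p q => B (e p) (e q)

theorem gramMatrix_sumElim (B : LinearMap.BilinForm K V) (u : ι → V) (w : κ → V)
    (huw : ∀ i k, B (u i) (w k) = 0) (hwu : ∀ i k, B (w k) (u i) = 0) :
    gramMatrix B (Sum.elim u w) = Matrix.fromBlocks (gramMatrix B u) 0 0 (gramMatrix B w) := by
  ext (i | i) (j | j) <;> simp [gramMatrix, huw, hwu]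

variable [Fintype ι]

theorem gramMatrix_basis_mulVec_repr (B : LinearMap.BilinForm K V) (e : Basis ι K V) (v : V) :
    (gramMatrix B e).mulVec (e.repr v) = fun q => B (e q) v := by
  ext q
  conv_rhs => rw [← e.sum_repr v]
  simp only [gramMatrix, Matrix.mulVec, dotProduct, Matrix.of_apply, map_sum, map_smul, smul_eq_mul,
    mul_comm]

variable [DecidableEq ι] [Fintype κ] [DecidableEq κ]

theorem nondegenerate_iff_det_gramMatrix_ne_zero {B : LinearMap.BilinForm K V}
    (e : Basis ι K V) : B.Nondegenerate ↔ (gramMatrix B e).det ≠ 0 := by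
  have hgram : gramMatrix B e = LinearMap.BilinForm.toMatrix e B := by
    ext p q
    simp [gramMatrix]
  rw [hgram, LinearMap.BilinForm.nondegenerate_iff_det_ne_zero e]

theorem repr_eq_sum_inv_gramMatrix {B : LinearMap.BilinForm K V} (e : Basis ι K V)
    (he : (gramMatrix B e).det ≠ 0) (v : V) (p : ι) :
    e.repr v p = ∑ q, (gramMatrix B e)⁻¹ p q * B (e q) v := by
  have h := congrArg ((gramMatrix B e)⁻¹.mulVec) (gramMatrix_basis_mulVec_repr B e v)
  rw [Matrix.mulVec_mulVec, Matrix.nonsing_inv_mul _ he.isUnit, Matrix.one_mulVec] at h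
  exact congrFun h p

theorem apply_eq_sum_inv_gramMatrix {B : LinearMap.BilinForm K V} (e : Basis ι K V)
    (he : (gramMatrix B e).det ≠ 0) (u v : V) :
    B u v = ∑ p, ∑ q, (gramMatrix B e)⁻¹ p q * (B u (e p) * B (e q) v) := by
  conv_lhs => rw [← e.sum_repr v]
  simp only [map_sum, map_smul, smul_eq_mul, repr_eq_sum_inv_gramMatrix e he, Finset.sum_mul]
  exact Finset.sum_congr rfl fun p _ => Finset.sum_congr rfl fun q _ => by ring

theorem trace_eq_sum_inv_gramMatrix {B : LinearMap.BilinForm K V} (e : Basis ι K V)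
    (he : (gramMatrix B e).det ≠ 0) (T : V →ₗ[K] V) :
    LinearMap.trace K V T = ∑ p, ∑ q, (gramMatrix B e)⁻¹ p q * B (e q) (T (e p)) := by
  rw [LinearMap.trace_eq_matrix_trace K e]
  exact Finset.sum_congr rfl fun p _ => by
    rw [Matrix.diag_apply, LinearMap.toMatrix_apply, repr_eq_sum_inv_gramMatrix e he]

theorem inv_gramMatrix_sumElim {B : LinearMap.BilinForm K V} {u : ι → V} {w : κ → V}
    (huw : ∀ i k, B (u i) (w k) = 0) (hwu : ∀ i k, B (w k) (u i) = 0)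
    (hu : (gramMatrix B u).det ≠ 0) (hw : (gramMatrix B w).det ≠ 0) :
    (gramMatrix B (Sum.elim u w))⁻¹
      = Matrix.fromBlocks (gramMatrix B u)⁻¹ 0 0 (gramMatrix B w)⁻¹ := by
  have hiff : IsUnit (gramMatrix B u) ↔ IsUnit (gramMatrix B w) := by
    simp only [Matrix.isUnit_iff_isUnit_det, isUnit_iff_ne_zero, ne_eq, hu, hw]
  rw [gramMatrix_sumElim B u w huw hwu, Matrix.inv_fromBlocks_zero₁₂_of_isUnit_iff _ _ _ hiff]
  simp

theorem linearIndependent_of_det_gramMatrix_ne_zero {B : LinearMap.BilinForm K V} {e : ι → V}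
    (he : (gramMatrix B e).det ≠ 0) : LinearIndependent K e := by
  refine Fintype.linearIndependent_iff.2 fun c hc => congrFun (?_ : c = 0)
  refine Matrix.eq_zero_of_mulVec_eq_zero he (funext fun q => ?_)
  calc (gramMatrix B e).mulVec c q = B (e q) (∑ p, c p • e p) := by
        simp [gramMatrix, Matrix.mulVec, dotProduct, mul_comm]
    _ = 0 := by rw [hc, map_zero]

end GramMatrix

/-! ### Levi-Civita connections on constant vector fields -/

section Smooth

variable {E F : Type*} [NormedAddCommGroup E] [NormedSpace ℝ E] [NormedAddCommGroup F]
  [NormedSpace ℝ F] {U : Set E} {x : E}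

theorem differentiableAt_of_contDiffOn {f : E → F} (hf : ContDiffOn ℝ ∞ f U) (hU : IsOpen U)
    (hx : x ∈ U) : DifferentiableAt ℝ f x :=
  (hf.contDiffAt (hU.mem_nhds hx)).differentiableAt (by simp)

theorem contDiffOn_fderiv {f : E → F} (hf : ContDiffOn ℝ ∞ f U) (hU : IsOpen U) :
    ContDiffOn ℝ ∞ (fderiv ℝ f) U :=
  hf.fderiv_of_isOpen hU (by simp)

theorem fderiv_fderiv_comm {f : E → F} (hf : ContDiffOn ℝ ∞ f U) (hU : IsOpen U) (hx : x ∈ U)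
    (a b : E) : fderiv ℝ (fderiv ℝ f) x a b = fderiv ℝ (fderiv ℝ f) x b a :=
  ((hf.contDiffAt (hU.mem_nhds hx)).isSymmSndFDerivAt (by simpa using ENat.LEInfty.out)).eq a b

theorem fderiv_congr_of_isOpen {f₁ f₂ : E → F} (hU : IsOpen U) (h : Set.EqOn f₁ f₂ U)
    (hx : x ∈ U) : fderiv ℝ f₁ x = fderiv ℝ f₂ x :=
  (h.eventuallyEq_of_mem (hU.mem_nhds hx)).fderiv_eq

theorem fderiv_clm_apply_const {H : Type*} [NormedAddCommGroup H] [NormedSpace ℝ H]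
    {f : E → F →L[ℝ] H} (hf : DifferentiableAt ℝ f x) (a : E) (u : F) :
    fderiv ℝ (fun y => f y u) x a = fderiv ℝ f x a u := by
  simp [fderiv_clm_apply hf (differentiableAt_const u)]

theorem fderiv_add_sum_mul {κ : Type*} [Fintype κ] {f : E → ℝ} {p q : κ → E → ℝ}
    (hf : ContDiffOn ℝ ∞ f U) (hp : ∀ k, ContDiffOn ℝ ∞ (p k) U)
    (hq : ∀ k, ContDiffOn ℝ ∞ (q k) U) (hU : IsOpen U) (hx : x ∈ U) :
    fderiv ℝ (fun y => f y + ∑ k, p k y * q k y) x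
      = fderiv ℝ f x + ∑ k, (p k x • fderiv ℝ (q k) x + q k x • fderiv ℝ (p k) x) := by
  have hD : ∀ {f : E → ℝ}, ContDiffOn ℝ ∞ f U → DifferentiableAt ℝ f x := fun hf =>
    differentiableAt_of_contDiffOn hf hU hx
  rw [fderiv_fun_add (hD hf) (DifferentiableAt.fun_sum fun k _ => (hD (hp k)).fun_mul (hD (hq k))),
    fderiv_fun_sum fun k _ => (hD (hp k)).fun_mul (hD (hq k))]
  simp only [fderiv_fun_mul (hD (hp _)) (hD (hq _))]

theorem fderiv_fderiv_add_sum_mul {κ : Type*} [Fintype κ] {f : E → ℝ} {p q : κ → E → ℝ}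
    (hf : ContDiffOn ℝ ∞ f U) (hp : ∀ k, ContDiffOn ℝ ∞ (p k) U)
    (hq : ∀ k, ContDiffOn ℝ ∞ (q k) U) (hU : IsOpen U) (hx : x ∈ U) (hpx : ∀ k, p k x = 0)
    (hqx : ∀ k, q k x = 0) (a c : E) :
    fderiv ℝ (fderiv ℝ fun y => f y + ∑ k, p k y * q k y) x a c
      = fderiv ℝ (fderiv ℝ f) x a c + ∑ k, (fderiv ℝ (p k) x a * fderiv ℝ (q k) x c
        + fderiv ℝ (p k) x c * fderiv ℝ (q k) x a) := by
  have hD : ∀ {f : E → ℝ}, ContDiffOn ℝ ∞ f U → DifferentiableAt ℝ f x := fun hf =>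
    differentiableAt_of_contDiffOn hf hU hx
  have hDD : ∀ {f : E → ℝ}, ContDiffOn ℝ ∞ f U → DifferentiableAt ℝ (fderiv ℝ f) x := fun hf =>
    differentiableAt_of_contDiffOn (contDiffOn_fderiv hf hU) hU hx
  have hpq : ∀ k, DifferentiableAt ℝ (fun y => p k y • fderiv ℝ (q k) y) x := fun k =>
    (hD (hp k)).fun_smul (hDD (hq k))
  have hqp : ∀ k, DifferentiableAt ℝ (fun y => q k y • fderiv ℝ (p k) y) x := fun k =>
    (hD (hq k)).fun_smul (hDD (hp k))
  rw [fderiv_congr_of_isOpen hU (fun y hy => fderiv_add_sum_mul hf hp hq hU hy) hx,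
    fderiv_fun_add (hDD hf) (DifferentiableAt.fun_sum fun k _ => (hpq k).fun_add (hqp k)),
    fderiv_fun_sum fun k _ => (hpq k).fun_add (hqp k)]
  simp only [fderiv_fun_add (hpq _) (hqp _), fderiv_fun_smul (hD (hp _)) (hDD (hq _)),
    fderiv_fun_smul (hD (hq _)) (hDD (hp _)), hpx, hqx]
  simp [mul_comm]

end Smooth

section LeviCivita

variable {E : Type*} [NormedAddCommGroup E] [NormedSpace ℝ E]

/-- `Γ x a b = ∇ₐ b` is the Levi-Civita connection, evaluated on constant vector fields, of the
possibly degenerate metric `g` on the open set `U`. -/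
structure IsLeviCivita (U : Set E) (g : E → E →L[ℝ] E →L[ℝ] ℝ) (Γ : E → E →L[ℝ] E →L[ℝ] E) :
    Prop where
  isOpen : IsOpen U
  contDiffOn_metric : ContDiffOn ℝ ∞ g U
  contDiffOn_connection : ContDiffOn ℝ ∞ Γ U
  symm : ∀ x ∈ U, ∀ u v, g x u v = g x v u
  torsion_free : ∀ x ∈ U, ∀ a b, Γ x a b = Γ x b a
  fderiv_metric : ∀ x ∈ U, ∀ a u v,
    fderiv ℝ (fun y => g y u v) x a = g x (Γ x a u) v + g x u (Γ x a v)

/-- The curvature `R(a, b) c` of the connection `Γ`, where constant vector fields have vanishing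
Lie brackets. -/
def connectionCurvature (Γ : E → E →L[ℝ] E →L[ℝ] E) (x : E) : E →L[ℝ] E →L[ℝ] E →L[ℝ] E :=
  let S := (ContinuousLinearMap.compL ℝ E E E).bilinearComp (Γ x) (Γ x)
  fderiv ℝ Γ x - (fderiv ℝ Γ x).flip + S - S.flip

theorem connectionCurvature_apply (Γ : E → E →L[ℝ] E →L[ℝ] E) (x a b c : E) :
    connectionCurvature Γ x a b c
      = fderiv ℝ Γ x a b c - fderiv ℝ Γ x b a c + Γ x a (Γ x b c) - Γ x b (Γ x a c) := by
  simp [connectionCurvature]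

theorem connectionCurvature_swap (Γ : E → E →L[ℝ] E →L[ℝ] E) (x a b c : E) :
    connectionCurvature Γ x a b c = -connectionCurvature Γ x b a c := by
  simp only [connectionCurvature_apply]
  abel

namespace IsLeviCivita

variable {U : Set E} {g : E → E →L[ℝ] E →L[ℝ] ℝ} {Γ : E → E →L[ℝ] E →L[ℝ] E} {x : E}

theorem contDiffOn_apply (hΓ : IsLeviCivita U g Γ) (u v : E) :
    ContDiffOn ℝ ∞ (fun y => g y u v) U :=
  (hΓ.contDiffOn_metric.clm_apply contDiffOn_const).clm_apply contDiffOn_const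

theorem koszul (hΓ : IsLeviCivita U g Γ) (hx : x ∈ U) (a b c : E) :
    g x (Γ x a b) c = 1 / 2 * (fderiv ℝ (fun y => g y b c) x a + fderiv ℝ (fun y => g y a c) x b
      - fderiv ℝ (fun y => g y a b) x c) := by
  rw [hΓ.fderiv_metric x hx, hΓ.fderiv_metric x hx, hΓ.fderiv_metric x hx,
    hΓ.torsion_free x hx b a, hΓ.torsion_free x hx c a, hΓ.torsion_free x hx c b,
    hΓ.symm x hx b, hΓ.symm x hx a]
  ring

theorem fderiv_koszul (hΓ : IsLeviCivita U g Γ) (hx : x ∈ U) (a b c d : E) :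
    fderiv ℝ (fun y => g y (Γ y b c) d) x a
      = 1 / 2 * (fderiv ℝ (fderiv ℝ fun y => g y c d) x a b
        + fderiv ℝ (fderiv ℝ fun y => g y b d) x a c
        - fderiv ℝ (fderiv ℝ fun y => g y b c) x a d) := by
  have hD : ∀ u v, DifferentiableAt ℝ (fderiv ℝ fun y => g y u v) x := fun u v =>
    differentiableAt_of_contDiffOn (contDiffOn_fderiv (hΓ.contDiffOn_apply u v) hΓ.isOpen)
      hΓ.isOpen hx
  have hDw : ∀ u v w, DifferentiableAt ℝ (fun y => fderiv ℝ (fun z => g z u v) y w) x :=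
    fun u v w => (hD u v).clm_apply (differentiableAt_const w)
  rw [fderiv_congr_of_isOpen hΓ.isOpen (fun y hy => hΓ.koszul hy b c d) hx,
    fderiv_const_mul (((hDw _ _ _).fun_add (hDw _ _ _)).fun_sub (hDw _ _ _)),
    fderiv_fun_sub ((hDw _ _ _).fun_add (hDw _ _ _)) (hDw _ _ _),
    fderiv_fun_add (hDw _ _ _) (hDw _ _ _)]
  simp [fderiv_clm_apply_const (hD _ _)]

theorem metric_fderiv_connection (hΓ : IsLeviCivita U g Γ) (hx : x ∈ U) (a b c d : E) :
    g x (fderiv ℝ Γ x a b c) d = fderiv ℝ (fun y => g y (Γ y b c) d) x a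
      - g x (Γ x a (Γ x b c)) d - g x (Γ x b c) (Γ x a d) := by
  have hg : DifferentiableAt ℝ g x :=
    differentiableAt_of_contDiffOn hΓ.contDiffOn_metric hΓ.isOpen hx
  have hΓx : DifferentiableAt ℝ Γ x :=
    differentiableAt_of_contDiffOn hΓ.contDiffOn_connection hΓ.isOpen hx
  have hΓbc : HasFDerivAt (fun y => Γ y b c) (((fderiv ℝ Γ x).flip b).flip c) x := by
    simpa using (hΓx.hasFDerivAt.clm_apply (hasFDerivAt_const b x)).clm_apply
      (hasFDerivAt_const c x)
  have hprod := (hg.hasFDerivAt.clm_apply hΓbc).clm_apply (hasFDerivAt_const d x)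
  rw [sub_sub, ← hΓ.fderiv_metric x hx, hprod.fderiv,
    fderiv_clm_apply_const (hg.clm_apply (differentiableAt_const _)), fderiv_clm_apply_const hg]
  simp

/-- Since the fields are constant, the first derivatives of `g` enter the curvature only through
scalar products of covariant derivatives. -/
theorem metric_curvature (hΓ : IsLeviCivita U g Γ) (hx : x ∈ U) (a b c d : E) :
    g x (connectionCurvature Γ x a b c) d
      = 1 / 2 * (fderiv ℝ (fderiv ℝ fun y => g y b d) x a c
          - fderiv ℝ (fderiv ℝ fun y => g y b c) x a d
          - fderiv ℝ (fderiv ℝ fun y => g y a d) x b c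
          + fderiv ℝ (fderiv ℝ fun y => g y a c) x b d)
        - g x (Γ x b c) (Γ x a d) + g x (Γ x a c) (Γ x b d) := by
  rw [connectionCurvature_apply]
  simp only [map_sub, map_add, sub_apply, add_apply]
  rw [hΓ.metric_fderiv_connection hx, hΓ.metric_fderiv_connection hx, hΓ.fderiv_koszul hx,
    hΓ.fderiv_koszul hx, fderiv_fderiv_comm (hΓ.contDiffOn_apply c d) hΓ.isOpen hx b a]
  ring

theorem metric_curvature_swap (hΓ : IsLeviCivita U g Γ) (hx : x ∈ U) (a b c d : E) :
    g x (connectionCurvature Γ x a b c) d = -g x (connectionCurvature Γ x a b d) c := by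
  rw [hΓ.metric_curvature hx, hΓ.metric_curvature hx, hΓ.symm x hx (Γ x b c),
    hΓ.symm x hx (Γ x a c)]
  ring

end IsLeviCivita

end LeviCivita

section Trilinear

open Module

variable {E F ι : Type*} [NormedAddCommGroup E] [NormedSpace ℝ E] [NormedAddCommGroup F]
  [NormedSpace ℝ F]

theorem clm_apply_eq_sum [Fintype ι] (e : Basis ι ℝ E) (T : E →L[ℝ] F) (v : E) :
    T v = ∑ i, e.repr v i • T (e i) := by
  conv_lhs => rw [← e.sum_repr v]
  simp only [map_sum, map_smul]

theorem trilinear_apply_eq_sum [Fintype ι] (e : Basis ι ℝ E)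
    (T : E →L[ℝ] E →L[ℝ] E →L[ℝ] F) (u v w : E) :
    T u v w = ∑ i, e.repr u i • ∑ j, e.repr v j • ∑ k, e.repr w k • T (e i) (e j) (e k) := by
  have hu := congrArg (fun S : E →L[ℝ] E →L[ℝ] F => S v w) (clm_apply_eq_sum e T u)
  simp only [sum_apply, smul_apply, clm_apply_eq_sum e (T (e _)) v] at hu
  simpa only [clm_apply_eq_sum e (T (e _) (e _)) w] using hu

theorem trilinear_ext [Finite ι] (e : Basis ι ℝ E) {S T : E →L[ℝ] E →L[ℝ] E →L[ℝ] F}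
    (h : ∀ i j k, S (e i) (e j) (e k) = T (e i) (e j) (e k)) : S = T := by
  have := Fintype.ofFinite ι
  ext u v w
  simp only [trilinear_apply_eq_sum e _ u, h]

theorem fderiv_metric_of_basis [Finite ι] (e : Basis ι ℝ E) {g : E → E →L[ℝ] E →L[ℝ] F} {x : E}
    (hg : DifferentiableAt ℝ g x) (hsymm : ∀ u v, g x u v = g x v u) {A : E →L[ℝ] E →L[ℝ] E}
    (h : ∀ i j k, fderiv ℝ (fun y => g y (e j) (e k)) x (e i)
      = g x (A (e i) (e j)) (e k) + g x (e j) (A (e i) (e k))) (a u v : E) :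
    fderiv ℝ (fun y => g y u v) x a = g x (A a u) v + g x u (A a v) := by
  have hD : ∀ a b c, fderiv ℝ (fun y => g y b c) x a = fderiv ℝ g x a b c := fun a b c => by
    rw [fderiv_clm_apply_const (hg.clm_apply (differentiableAt_const _)),
      fderiv_clm_apply_const hg]
  let P : E →L[ℝ] E →L[ℝ] E →L[ℝ] F := (ContinuousLinearMap.compL ℝ E E (E →L[ℝ] F) (g x)).comp A
  let Q : E →L[ℝ] E →L[ℝ] E →L[ℝ] F :=
    (ContinuousLinearMap.flipₗᵢ ℝ E E F : (E →L[ℝ] E →L[ℝ] F) →L[ℝ] E →L[ℝ] E →L[ℝ] F).comp P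
  have hPQ : ∀ a u v, (P + Q) a u v = g x (A a u) v + g x u (A a v) := fun a u v => by
    simp [P, Q, hsymm u]
  have hbasis : fderiv ℝ g x = P + Q :=
    trilinear_ext e fun i j k => by rw [← hD, h, hPQ]
  rw [hD, hbasis, hPQ]

end Trilinear

/-! ### Metrics in coordinates -/

section Coordinates

open Module

/-- The coordinate space `ℝⁿ`. -/
abbrev Coords (n : ℕ) : Type := EuclideanSpace ℝ (Fin n)

/-- The coordinate vectors `∂₁, …, ∂ₙ`. -/
def coordBasis (n : ℕ) : Basis (Fin n) ℝ (Coords n) :=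
  (EuclideanSpace.basisFun (Fin n) ℝ).toBasis

@[simp]
theorem coordBasis_apply {n : ℕ} (i : Fin n) : coordBasis n i = EuclideanSpace.single i 1 := by
  simp [coordBasis]

@[simp]
theorem coordBasis_repr {n : ℕ} (v : Coords n) (i : Fin n) : (coordBasis n).repr v i = v i := by
  simp [coordBasis]

variable {n : ℕ} {E F : Type*} [NormedAddCommGroup E] [NormedSpace ℝ E] [NormedAddCommGroup F]
  [NormedSpace ℝ F]

/-- The bilinear map with coefficients `c i j` on `ℝⁿ`. -/
def bilinearOfCoeff (c : Fin n → Fin n → F) : Coords n →L[ℝ] Coords n →L[ℝ] F :=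
  ∑ i, ∑ j, (EuclideanSpace.proj i).smulRight ((EuclideanSpace.proj j).smulRight (c i j))

theorem bilinearOfCoeff_apply (c : Fin n → Fin n → F) (u v : Coords n) :
    bilinearOfCoeff c u v = ∑ i, ∑ j, u i • v j • c i j := by
  simp [bilinearOfCoeff]

@[simp]
theorem bilinearOfCoeff_single (c : Fin n → Fin n → F) (i j : Fin n) :
    bilinearOfCoeff c (EuclideanSpace.single i 1) (EuclideanSpace.single j 1) = c i j := by
  simp [bilinearOfCoeff_apply]

theorem contDiffOn_bilinearOfCoeff {m : WithTop ℕ∞} {U : Set E} {c : Fin n → Fin n → E → F}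
    (hc : ∀ i j, ContDiffOn ℝ m (c i j) U) :
    ContDiffOn ℝ m (fun y => bilinearOfCoeff fun i j => c i j y) U := by
  refine contDiffOn_clm_apply.2 fun u => contDiffOn_clm_apply.2 fun v => ?_
  simp only [bilinearOfCoeff_apply]
  exact ContDiffOn.sum fun i _ => ContDiffOn.sum fun j _ =>
    ((hc i j).const_smul (v j)).const_smul (u i)

theorem contDiffOn_det {ι : Type*} [Fintype ι] [DecidableEq ι] {m : WithTop ℕ∞} {U : Set E}
    {A : E → Matrix ι ι ℝ} (hA : ∀ i j, ContDiffOn ℝ m (fun y => A y i j) U) :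
    ContDiffOn ℝ m (fun y => (A y).det) U := by
  simp only [Matrix.det_apply']
  exact ContDiffOn.sum fun σ _ => contDiffOn_const.mul (contDiffOn_prod fun i _ => hA _ _)

theorem contDiffOn_matrix_inv {ι : Type*} [Fintype ι] [DecidableEq ι] {m : WithTop ℕ∞}
    {U : Set E} {A : E → Matrix ι ι ℝ} (hA : ∀ i j, ContDiffOn ℝ m (fun y => A y i j) U)
    (hdet : ∀ y ∈ U, (A y).det ≠ 0) (i j : ι) : ContDiffOn ℝ m (fun y => (A y)⁻¹ i j) U := by
  simp only [Matrix.inv_def, Ring.inverse_eq_inv', Matrix.smul_apply, smul_eq_mul,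
    Matrix.adjugate_apply]
  refine ((contDiffOn_det hA).inv hdet).mul (contDiffOn_det fun k l => ?_)
  simp only [Matrix.updateRow_apply]
  split_ifs
  exacts [contDiffOn_const, hA k l]

/-- The bilinear form `g(u, v)` at `x` of the metric with components `G`. -/
def coordForm (G : Coords n → Matrix (Fin n) (Fin n) ℝ) (x : Coords n) :
    Coords n →L[ℝ] Coords n →L[ℝ] ℝ :=
  bilinearOfCoeff fun i j => G x i j

/-- The Levi-Civita connection of the metric with components `G`: the `k`-th component of
`christoffelMap G x u v` is `Γᵏᵢⱼ uⁱ vʲ`. -/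
def christoffelMap (G : Coords n → Matrix (Fin n) (Fin n) ℝ) (x : Coords n) :
    Coords n →L[ℝ] Coords n →L[ℝ] Coords n :=
  bilinearOfCoeff fun i j => WithLp.toLp 2 fun k => christoffel G k i j x

theorem coordForm_apply (G : Coords n → Matrix (Fin n) (Fin n) ℝ) (x u v : Coords n) :
    coordForm G x u v = coordInner G x u v := by
  simp only [coordForm, bilinearOfCoeff_apply, coordInner, smul_eq_mul]
  exact Finset.sum_congr rfl fun i _ => Finset.sum_congr rfl fun j _ => by ring

theorem coordForm_single_right (G : Coords n → Matrix (Fin n) (Fin n) ℝ) (x u : Coords n)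
    (k : Fin n) : coordForm G x u (EuclideanSpace.single k 1) = ∑ l, u l * G x l k := by
  simp [coordForm, bilinearOfCoeff_apply]

/-- `G` is the matrix of components of a smooth pseudo-Riemannian metric on the open set `U`. -/
structure IsCoordMetric (U : Set (Coords n)) (G : Coords n → Matrix (Fin n) (Fin n) ℝ) :
    Prop where
  isOpen : IsOpen U
  contDiffOn : ∀ i j, ContDiffOn ℝ ∞ (fun y => G y i j) U
  symm : ∀ x ∈ U, ∀ i j, G x i j = G x j i
  det_ne_zero : ∀ x ∈ U, (G x).det ≠ 0

namespace IsCoordMetric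

variable {U : Set (Coords n)} {G : Coords n → Matrix (Fin n) (Fin n) ℝ} {x : Coords n}

theorem partialDeriv_symm (hG : IsCoordMetric U G) (hx : x ∈ U) (i j k : Fin n) :
    partialDeriv i (fun y => G y j k) x = partialDeriv i (fun y => G y k j) x := by
  rw [partialDeriv, partialDeriv,
    fderiv_congr_of_isOpen hG.isOpen (fun y hy => hG.symm y hy j k) hx]

theorem contDiffOn_partialDeriv (hG : IsCoordMetric U G) (i j k : Fin n) :
    ContDiffOn ℝ ∞ (partialDeriv i fun y => G y j k) U :=
  (contDiffOn_fderiv (hG.contDiffOn j k) hG.isOpen).clm_apply contDiffOn_const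

theorem contDiffOn_christoffel (hG : IsCoordMetric U G) (k i j : Fin n) :
    ContDiffOn ℝ ∞ (christoffel G k i j) U :=
  contDiffOn_const.mul (ContDiffOn.sum fun l _ =>
    (contDiffOn_matrix_inv hG.contDiffOn hG.det_ne_zero k l).mul
      (((hG.contDiffOn_partialDeriv i l j).add (hG.contDiffOn_partialDeriv j l i)).sub
        (hG.contDiffOn_partialDeriv l i j)))

theorem christoffel_symm (hG : IsCoordMetric U G) (hx : x ∈ U) (k i j : Fin n) :
    christoffel G k i j x = christoffel G k j i x := by
  simp only [christoffel, hG.partialDeriv_symm hx _ i j, add_comm]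

theorem sum_christoffel_mul (hG : IsCoordMetric U G) (hx : x ∈ U) (i j k : Fin n) :
    ∑ l, christoffel G l i j x * G x l k
      = 1 / 2 * (partialDeriv i (fun y => G y k j) x + partialDeriv j (fun y => G y k i) x
        - partialDeriv k (fun y => G y i j) x) := by
  set c : Fin n → ℝ := fun l => partialDeriv i (fun y => G y l j) x
    + partialDeriv j (fun y => G y l i) x - partialDeriv l (fun y => G y i j) x
  have hinv : G x * (G x)⁻¹ = 1 := Matrix.mul_nonsing_inv _ (hG.det_ne_zero x hx).isUnit
  calc ∑ l, christoffel G l i j x * G x l k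
      = 1 / 2 * (G x).mulVec ((G x)⁻¹.mulVec c) k := by
        simp only [christoffel, Matrix.mulVec, dotProduct, Finset.mul_sum, hG.symm x hx k, c]
        exact Finset.sum_congr rfl fun l _ => by rw [Finset.sum_mul]; congr! 1; ring
    _ = 1 / 2 * c k := by rw [Matrix.mulVec_mulVec, hinv, Matrix.one_mulVec]

theorem contDiffOn_coordForm (hG : IsCoordMetric U G) : ContDiffOn ℝ ∞ (coordForm G) U :=
  contDiffOn_bilinearOfCoeff hG.contDiffOn

theorem coordForm_symm (hG : IsCoordMetric U G) (hx : x ∈ U) (u v : Coords n) :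
    coordForm G x u v = coordForm G x v u := by
  simp only [coordForm, bilinearOfCoeff_apply]
  rw [Finset.sum_comm]
  simp only [smul_eq_mul, hG.symm x hx, mul_left_comm]

theorem isLeviCivita (hG : IsCoordMetric U G) :
    IsLeviCivita U (coordForm G) (christoffelMap G) where
  isOpen := hG.isOpen
  contDiffOn_metric := hG.contDiffOn_coordForm
  contDiffOn_connection := contDiffOn_bilinearOfCoeff fun i j =>
    contDiffOn_euclidean.2 fun k => hG.contDiffOn_christoffel k i j
  symm _ hx := hG.coordForm_symm hx
  torsion_free x hx u v := by
    simp only [christoffelMap, bilinearOfCoeff_apply]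
    rw [Finset.sum_comm]
    refine Finset.sum_congr rfl fun j _ => Finset.sum_congr rfl fun i _ => ?_
    rw [smul_comm, funext fun k => hG.christoffel_symm hx k i j]
  fderiv_metric x hx := by
    have hchr : ∀ i j k, coordForm G x (christoffelMap G x (EuclideanSpace.single i 1)
        (EuclideanSpace.single j 1)) (EuclideanSpace.single k 1)
          = ∑ l, christoffel G l i j x * G x l k := fun i j k => by
      simp [coordForm_single_right, christoffelMap]
    refine fderiv_metric_of_basis (coordBasis n)
      (differentiableAt_of_contDiffOn hG.contDiffOn_coordForm hG.isOpen hx)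
      (hG.coordForm_symm hx) fun i j k => ?_
    simp only [coordBasis_apply]
    rw [hG.coordForm_symm hx (EuclideanSpace.single j 1), hchr, hchr, hG.sum_christoffel_mul hx,
      hG.sum_christoffel_mul hx, hG.partialDeriv_symm hx i k j, hG.partialDeriv_symm hx j k i,
      hG.partialDeriv_symm hx k j i]
    simp only [coordForm, bilinearOfCoeff_single, partialDeriv]
    ring

theorem connectionCurvature_single (hG : IsCoordMetric U G) (hx : x ∈ U) (i j k l : Fin n) :
    connectionCurvature (christoffelMap G) x (EuclideanSpace.single i 1)
      (EuclideanSpace.single j 1) (EuclideanSpace.single k 1) l = riemann G l k i j x := by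
  have hD : ∀ a b c, fderiv ℝ (christoffelMap G) x (EuclideanSpace.single a 1)
      (EuclideanSpace.single b 1) (EuclideanSpace.single c 1) l
        = partialDeriv a (christoffel G l b c) x := fun a b c => by
    have hΓ := differentiableAt_of_contDiffOn hG.isLeviCivita.contDiffOn_connection hG.isOpen hx
    have hΓb := hΓ.clm_apply (differentiableAt_const (EuclideanSpace.single b (1 : ℝ)))
    have hΓbc := hΓb.clm_apply (differentiableAt_const (EuclideanSpace.single c (1 : ℝ)))
    rw [← fderiv_clm_apply_const hΓ, ← fderiv_clm_apply_const hΓb, partialDeriv]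
    have hl := ((EuclideanSpace.proj l).hasFDerivAt.comp x hΓbc.hasFDerivAt).fderiv
    simpa [christoffelMap, Function.comp_def] using
      (congrArg (· (EuclideanSpace.single a 1)) hl).symm
  have hΓ : ∀ a b c d, christoffelMap G x (EuclideanSpace.single a 1)
      (christoffelMap G x (EuclideanSpace.single b 1) (EuclideanSpace.single c 1)) d
        = ∑ m, christoffel G d a m x * christoffel G m b c x := fun a b c d => by
    simp [christoffelMap, bilinearOfCoeff_apply, mul_comm]
  rw [connectionCurvature_apply, riemann, Finset.sum_sub_distrib, ← hΓ, ← hΓ, ← hD, ← hD]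
  simp only [PiLp.add_apply, PiLp.sub_apply]
  ring

theorem curvatureOp_eq_connectionCurvature (hG : IsCoordMetric U G) (hx : x ∈ U)
    (u v w : Coords n) :
    curvatureOp G x u v w = connectionCurvature (christoffelMap G) x u v w := by
  ext l
  rw [trilinear_apply_eq_sum (coordBasis n)]
  simp only [curvatureOp, coordBasis_repr, coordBasis_apply, PiLp.smul_apply, WithLp.ofLp_sum,
    Finset.sum_apply, hG.connectionCurvature_single hx, smul_eq_mul, Finset.mul_sum]
  rw [Finset.sum_comm]
  refine Finset.sum_congr rfl fun i _ => ?_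
  rw [Finset.sum_comm]
  exact Finset.sum_congr rfl fun j _ => Finset.sum_congr rfl fun k _ => by ring

end IsCoordMetric

end Coordinates

/-! ### Curvature of a splitting -/

section Splitting

variable {K V ι κ μ : Type*} [Field K] [AddCommGroup V] [Module K V]

/-- The symmetries of the curvature operator `R(a, b) c` of a metric connection at a point where
the metric is `B`; the Bianchi identity is not required. -/
structure IsCurvatureOperator (B : LinearMap.BilinForm K V) (R : V → V → V → V) : Prop where
  symm : ∀ a b, B a b = B b a
  antisymm : ∀ a b c, R a b c = -R b a c
  skew : ∀ a b c d, B (R a b c) d = -B (R a b d) c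

variable [Fintype ι] [DecidableEq ι] [Fintype κ] [DecidableEq κ] [Fintype μ]
  [DecidableEq μ]

/-- The trace of `a ↦ R(a, b) c` over the span of `u`; this is the Ricci curvature if `u` is a
basis. -/
def partialRicci (B : LinearMap.BilinForm K V) (R : V → V → V → V) (u : ι → V) (b c : V) : K :=
  ∑ p, ∑ q, (gramMatrix B u)⁻¹ p q * B (u q) (R (u p) b c)

/-- The double trace of the curvature over the span of `u` and the span of `w`. -/
def mutualCurvature (B : LinearMap.BilinForm K V) (R : V → V → V → V) (u : ι → V) (w : κ → V) : K :=
  ∑ r, ∑ s, (gramMatrix B w)⁻¹ r s * partialRicci B R u (w r) (w s)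

/-- The sectional curvature of the plane spanned by `u` and `v`, with value `0` on a degenerate
plane. -/
def sectionalCurvature (B : LinearMap.BilinForm K V) (R : V → V → V → V) (u v : V) : K :=
  B (R u v v) u / (B u u * B v v - B u v ^ 2)

theorem sum_inv_mul_self {A : Matrix ι ι K} (hA : A.det ≠ 0) (hsymm : A.IsSymm) :
    ∑ r, ∑ s, A⁻¹ r s * A r s = Fintype.card ι := by
  calc ∑ r, ∑ s, A⁻¹ r s * A r s = (A⁻¹ * A).trace := by
        simp only [Matrix.trace, Matrix.diag_apply, Matrix.mul_apply, hsymm.apply]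
    _ = Fintype.card ι := by rw [Matrix.nonsing_inv_mul _ hA.isUnit, Matrix.trace_one]

namespace IsCurvatureOperator

variable {B : LinearMap.BilinForm K V} {R : V → V → V → V}

theorem mutualCurvature_comm (hR : IsCurvatureOperator B R) (u : ι → V) (w : κ → V) :
    mutualCurvature B R u w = mutualCurvature B R w u := by
  have hswap : ∀ p q r s, B (u q) (R (u p) (w r) (w s)) = B (w s) (R (w r) (u p) (u q)) :=
    fun p q r s => by
      rw [hR.symm, hR.skew, hR.antisymm (u p), map_neg, LinearMap.neg_apply, neg_neg, hR.symm]
  simp only [mutualCurvature, partialRicci, hswap, Finset.mul_sum]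
  simp_rw [Finset.sum_comm (s := Finset.univ (α := κ)) (t := Finset.univ (α := ι))]
  refine Finset.sum_congr rfl fun p _ => Finset.sum_congr rfl fun q _ =>
    Finset.sum_congr rfl fun r _ => Finset.sum_congr rfl fun s _ => by ring

theorem det_gramMatrix_fin_two (hR : IsCurvatureOperator B R) (v : Fin 2 → V) :
    (gramMatrix B v).det = B (v 0) (v 0) * B (v 1) (v 1) - B (v 0) (v 1) ^ 2 := by
  rw [Matrix.det_fin_two, gramMatrix]
  simp only [Matrix.of_apply, hR.symm (v 1) (v 0), sq]

theorem mutualCurvature_self_fin_two [NeZero (2 : K)] (hR : IsCurvatureOperator B R)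
    (v : Fin 2 → V) :
    mutualCurvature B R v v = 2 * sectionalCurvature B R (v 0) (v 1) := by
  have hleft : ∀ a c d, B (R a a c) d = 0 := fun a c d => by
    have h := congrArg (B · d) (hR.antisymm a a c)
    rwa [map_neg, LinearMap.neg_apply, eq_neg_iff_add_eq_zero, ← two_mul,
      mul_eq_zero_iff_left two_ne_zero] at h
  have hright : ∀ a b c, B (R a b c) c = 0 := fun a b c => by
    have h := hR.skew a b c c
    rwa [eq_neg_iff_add_eq_zero, ← two_mul, mul_eq_zero_iff_left two_ne_zero] at h
  have hcol : ∀ c d, B (R (v 1) (v 0) c) d = -B (R (v 0) (v 1) c) d := fun c d => by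
    rw [hR.antisymm, map_neg, LinearMap.neg_apply]
  have hinv : (gramMatrix B v)⁻¹ 0 0 * (gramMatrix B v)⁻¹ 1 1
      - (gramMatrix B v)⁻¹ 0 1 * (gramMatrix B v)⁻¹ 1 0 = (gramMatrix B v).det⁻¹ := by
    rw [← Matrix.det_fin_two, Matrix.det_nonsing_inv, Ring.inverse_eq_inv']
  rw [sectionalCurvature, ← hR.det_gramMatrix_fin_two, div_eq_mul_inv, ← hinv]
  simp only [mutualCurvature, partialRicci, hR.symm (v _) (R _ _ _), Fin.sum_univ_two, hleft,
    hright, hcol, hR.skew _ _ (v 0) (v 1)]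
  ring

theorem mutualCurvature_add (hR : IsCurvatureOperator B R) {u : ι → V} {w : κ → V} {z : μ → V}
    {Λ : K} (huw : ∀ i k, B (u i) (w k) = 0) (hu : (gramMatrix B u).det ≠ 0)
    (hw : (gramMatrix B w).det ≠ 0) (hz : (gramMatrix B z).det ≠ 0)
    (hric : ∀ b c, partialRicci B R (Sum.elim u w) b c = Λ * B b c) :
    mutualCurvature B R u z + mutualCurvature B R w z = Λ * Fintype.card μ := by
  have hwu : ∀ i k, B (w k) (u i) = 0 := fun i k => (hR.symm _ _).trans (huw i k)
  have hsplit : ∀ b c, partialRicci B R u b c + partialRicci B R w b c = Λ * B b c := fun b c => by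
    rw [← hric, partialRicci, partialRicci, partialRicci, inv_gramMatrix_sumElim huw hwu hu hw]
    simp
  have hsymm : (gramMatrix B z).IsSymm := Matrix.IsSymm.ext fun r s => hR.symm _ _
  calc mutualCurvature B R u z + mutualCurvature B R w z
      = ∑ r, ∑ s, (gramMatrix B z)⁻¹ r s * (Λ * B (z r) (z s)) := by
        simp only [mutualCurvature, ← Finset.sum_add_distrib, ← mul_add, hsplit]
    _ = Λ * ∑ r, ∑ s, (gramMatrix B z)⁻¹ r s * gramMatrix B z r s := by
        simp only [Finset.mul_sum, gramMatrix, Matrix.of_apply, mul_left_comm]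
    _ = Λ * Fintype.card μ := by rw [sum_inv_mul_self hz hsymm]

/-- Tracing the Ricci curvature over `u` and over `w` produces the same mixed term. -/
theorem mutualCurvature_self_sub_self (hR : IsCurvatureOperator B R) {u : ι → V} {w : κ → V} {Λ : K}
    (huw : ∀ i k, B (u i) (w k) = 0) (hu : (gramMatrix B u).det ≠ 0)
    (hw : (gramMatrix B w).det ≠ 0)
    (hric : ∀ b c, partialRicci B R (Sum.elim u w) b c = Λ * B b c) :
    mutualCurvature B R u u - mutualCurvature B R w w
      = Λ * (Fintype.card ι - Fintype.card κ) := by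
  have huu := hR.mutualCurvature_add huw hu hw hu hric
  have hww := hR.mutualCurvature_add huw hu hw hw hric
  rw [hR.mutualCurvature_comm w u] at huu
  linear_combination huu - hww

theorem sectionalCurvature_eq_of_einstein [NeZero (2 : K)] (hR : IsCurvatureOperator B R)
    {u w : Fin 2 → V} {Λ : K} (huw : ∀ i k, B (u i) (w k) = 0) (hu : (gramMatrix B u).det ≠ 0)
    (hw : (gramMatrix B w).det ≠ 0)
    (hric : ∀ b c, partialRicci B R (Sum.elim u w) b c = Λ * B b c) :
    sectionalCurvature B R (u 0) (u 1) = sectionalCurvature B R (w 0) (w 1) := by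
  have h := hR.mutualCurvature_self_sub_self huw hu hw hric
  rw [sub_self, mul_zero, sub_eq_zero, hR.mutualCurvature_self_fin_two,
    hR.mutualCurvature_self_fin_two] at h
  exact mul_left_cancel₀ two_ne_zero h

end IsCurvatureOperator

end Splitting

/-! ### Sectional, Ricci and scalar curvature in coordinates -/

section CoordCurvature

open Module

theorem partialRicci_eq_trace {K V ι : Type*} [Field K] [AddCommGroup V] [Module K V] [Fintype ι]
    [DecidableEq ι] {B : LinearMap.BilinForm K V} (e : Basis ι K V) (he : (gramMatrix B e).det ≠ 0)
    {R : V → V → V → V} {b c : V} (T : V →ₗ[K] V) (hT : ∀ a, T a = R a b c) :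
    partialRicci B R e b c = LinearMap.trace K V T := by
  simp only [trace_eq_sum_inv_gramMatrix e he, partialRicci, hT]

variable {n : ℕ} {G : Coords n → Matrix (Fin n) (Fin n) ℝ}

/-- The algebraic bilinear form underlying `coordForm`. -/
def coordBilin (G : Coords n → Matrix (Fin n) (Fin n) ℝ) (x : Coords n) :
    LinearMap.BilinForm ℝ (Coords n) :=
  (coordForm G x).toLinearMap₁₂

@[simp]
theorem coordBilin_apply (x u v : Coords n) : coordBilin G x u v = coordForm G x u v := rfl

theorem coordSectional_eq_sectionalCurvature (x u v : Coords n) :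
    coordSectional G x u v = sectionalCurvature (coordBilin G x) (curvatureOp G x) u v := by
  simp only [coordSectional, sectionalCurvature, coordBilin_apply, coordForm_apply]

theorem gramMatrix_coordBasis (x : Coords n) :
    gramMatrix (coordBilin G x) (coordBasis n) = G x := by
  ext i j
  simp [gramMatrix, coordForm]

namespace IsCoordMetric

variable {U : Set (Coords n)} {x : Coords n}

theorem nondegenerate_coordBilin (hG : IsCoordMetric U G) (hx : x ∈ U) :
    (coordBilin G x).Nondegenerate := by
  rw [nondegenerate_iff_det_gramMatrix_ne_zero (coordBasis n), gramMatrix_coordBasis]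
  exact hG.det_ne_zero x hx

theorem isCurvatureOperator (hG : IsCoordMetric U G) (hx : x ∈ U) :
    IsCurvatureOperator (coordBilin G x) (curvatureOp G x) where
  symm := hG.coordForm_symm hx
  antisymm a b c := by
    simp only [hG.curvatureOp_eq_connectionCurvature hx, connectionCurvature_swap _ x a]
  skew a b c d := by
    simp only [hG.curvatureOp_eq_connectionCurvature hx, coordBilin_apply]
    exact hG.isLeviCivita.metric_curvature_swap hx a b c d

theorem partialRicci_basis {ι : Type*} [Fintype ι] [DecidableEq ι] (hG : IsCoordMetric U G)
    (hx : x ∈ U) (e : Basis ι ℝ (Coords n)) (b c : Coords n) :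
    partialRicci (coordBilin G x) (curvatureOp G x) e b c
      = ∑ j, ∑ k, b j * c k * ricci G j k x := by
  have he := (nondegenerate_iff_det_gramMatrix_ne_zero e).1 (hG.nondegenerate_coordBilin hx)
  rw [partialRicci_eq_trace e he
    (((connectionCurvature (christoffelMap G) x).flip b).flip c).toLinearMap fun a => by
      simp [hG.curvatureOp_eq_connectionCurvature hx],
    LinearMap.trace_eq_matrix_trace ℝ (coordBasis n)]
  calc ∑ i, LinearMap.toMatrix (coordBasis n) (coordBasis n)
        (((connectionCurvature (christoffelMap G) x).flip b).flip c).toLinearMap i i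
      = ∑ i, curvatureOp G x (EuclideanSpace.single i 1) b c i := by
        simp [LinearMap.toMatrix_apply, hG.curvatureOp_eq_connectionCurvature hx]
    _ = ∑ i, ∑ k, ∑ j, riemann G i k i j x * b j * c k := by simp [curvatureOp]
    _ = ∑ k, ∑ j, ∑ i, riemann G i k i j x * b j * c k := by
        rw [Finset.sum_comm]
        exact Finset.sum_congr rfl fun k _ => Finset.sum_comm
    _ = ∑ j, ∑ k, b j * c k * ricci G j k x := by
        rw [Finset.sum_comm]
        simp only [ricci, Finset.mul_sum, mul_comm (riemann _ _ _ _ _ _), mul_right_comm]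

theorem partialRicci_of_einstein {ι : Type*} [Fintype ι] [DecidableEq ι] (hG : IsCoordMetric U G)
    (hx : x ∈ U) {Λ : ℝ} (hΛ : ∀ j k, ricci G j k x = Λ * G x j k)
    (e : Basis ι ℝ (Coords n)) (b c : Coords n) :
    partialRicci (coordBilin G x) (curvatureOp G x) e b c = Λ * coordBilin G x b c := by
  rw [hG.partialRicci_basis hx, coordBilin_apply, coordForm_apply, coordInner, Finset.mul_sum]
  simp only [hΛ, Finset.mul_sum]
  exact Finset.sum_congr rfl fun j _ => Finset.sum_congr rfl fun k _ => by ring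

theorem scalarCurvature_eq_mutualCurvature (hG : IsCoordMetric U G) (hx : x ∈ U) :
    scalarCurvature G x
      = mutualCurvature (coordBilin G x) (curvatureOp G x) (coordBasis n) (coordBasis n) := by
  simp [scalarCurvature, mutualCurvature, gramMatrix_coordBasis, hG.partialRicci_basis hx]

end IsCoordMetric

theorem IsCoordMetric.scalarCurvature_fin_two {G : E2 → Matrix (Fin 2) (Fin 2) ℝ} {U : Set E2}
    {x : E2} (hG : IsCoordMetric U G) (hx : x ∈ U) :
    scalarCurvature G x
      = 2 * coordSectional G x (EuclideanSpace.single 0 1) (EuclideanSpace.single 1 1) := by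
  rw [hG.scalarCurvature_eq_mutualCurvature hx,
    (hG.isCurvatureOperator hx).mutualCurvature_self_fin_two, coordSectional_eq_sectionalCurvature,
    coordBasis_apply, coordBasis_apply]

end CoordCurvature

/-! ### Frames adapted to Killing fields -/

section KillingFrame

open Module

variable {E E' ι κ : Type*} [NormedAddCommGroup E] [NormedSpace ℝ E] [NormedAddCommGroup E']
  [NormedSpace ℝ E'] [Fintype κ] [DecidableEq κ]

/-- The derivative of the scalar product of the `j`-th horizontal and the `k`-th vertical field of
the frame `e` along the `i`-th horizontal one. -/
def shear (g : E → E →L[ℝ] E →L[ℝ] ℝ) (x : E) (e : Basis (ι ⊕ κ) ℝ E) (i j : ι) (k : κ) : ℝ :=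
  fderiv ℝ (fun y => g y (e (.inl j)) (e (.inr k))) x (e (.inl i))

/-- The scalar product of two vertical covectors, given by their values on the vertical fields of
the frame `e`. -/
def verticalInner (g : E → E →L[ℝ] E →L[ℝ] ℝ) (x : E) (e : Basis (ι ⊕ κ) ℝ E) :
    LinearMap.BilinForm ℝ (κ → ℝ) :=
  Matrix.toBilin' (gramMatrix (g x).toLinearMap₁₂ (e ∘ Sum.inr))⁻¹

theorem verticalInner_comm {g : E → E →L[ℝ] E →L[ℝ] ℝ} {x : E} (e : Basis (ι ⊕ κ) ℝ E)
    (hsymm : ∀ a b, g x a b = g x b a) (u w : κ → ℝ) :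
    verticalInner g x e u w = verticalInner g x e w u := by
  have hgram : (gramMatrix (g x).toLinearMap₁₂ (e ∘ Sum.inr)).transpose
      = gramMatrix (g x).toLinearMap₁₂ (e ∘ Sum.inr) := by
    ext k l
    exact hsymm _ _
  have hinv : ∀ k l, (gramMatrix (g x).toLinearMap₁₂ (e ∘ Sum.inr))⁻¹ k l
      = (gramMatrix (g x).toLinearMap₁₂ (e ∘ Sum.inr))⁻¹ l k := fun k l => by
    conv_lhs => rw [← hgram, ← Matrix.transpose_nonsing_inv, Matrix.transpose_apply]
  rw [verticalInner, Matrix.toBilin'_apply, Matrix.toBilin'_apply, Finset.sum_comm]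
  exact Finset.sum_congr rfl fun l _ => Finset.sum_congr rfl fun k _ => by rw [hinv k l]; ring

variable [Fintype ι] [DecidableEq ι]

/-- `e` is a basis of constant vector fields whose vertical part `e ∘ Sum.inr` consists of Killing
fields and, at `x`, is nondegenerate and orthogonal to the horizontal part `e ∘ Sum.inl`. -/
structure IsKillingFrame (U : Set E) (g : E → E →L[ℝ] E →L[ℝ] ℝ) (x : E)
    (e : Basis (ι ⊕ κ) ℝ E) : Prop where
  killing : ∀ y ∈ U, ∀ k a b, fderiv ℝ (fun z => g z a b) y (e (.inr k)) = 0
  orthogonal : ∀ i k, g x (e (.inl i)) (e (.inr k)) = 0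
  det_horizontal_ne_zero : (gramMatrix (g x).toLinearMap₁₂ (e ∘ Sum.inl)).det ≠ 0
  det_vertical_ne_zero : (gramMatrix (g x).toLinearMap₁₂ (e ∘ Sum.inr)).det ≠ 0

namespace IsKillingFrame

variable {U : Set E} {g : E → E →L[ℝ] E →L[ℝ] ℝ} {Γ : E → E →L[ℝ] E →L[ℝ] E} {x : E}
  {e : Basis (ι ⊕ κ) ℝ E}

theorem apply_eq_horizontal_add_vertical (he : IsKillingFrame U g x e)
    (hsymm : ∀ a b, g x a b = g x b a) (u w : E) :
    g x u w
      = ∑ i, ∑ j, (gramMatrix (g x).toLinearMap₁₂ (e ∘ Sum.inl))⁻¹ i j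
          * (g x u (e (.inl i)) * g x w (e (.inl j)))
        + ∑ k, ∑ l, (gramMatrix (g x).toLinearMap₁₂ (e ∘ Sum.inr))⁻¹ k l
          * (g x u (e (.inr k)) * g x w (e (.inr l))) := by
  have hsplit : (e : ι ⊕ κ → E) = Sum.elim (e ∘ Sum.inl) (e ∘ Sum.inr) :=
    (Sum.elim_comp_inl_inr e).symm
  have hhv : ∀ i k, (g x).toLinearMap₁₂ ((e ∘ Sum.inl) i) ((e ∘ Sum.inr) k) = 0 := he.orthogonal
  have hvh : ∀ i k, (g x).toLinearMap₁₂ ((e ∘ Sum.inr) k) ((e ∘ Sum.inl) i) = 0 := fun i k =>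
    (hsymm _ _).trans (he.orthogonal i k)
  have hdet : (gramMatrix (g x).toLinearMap₁₂ e).det ≠ 0 := by
    rw [hsplit, gramMatrix_sumElim _ _ _ hhv hvh, Matrix.det_fromBlocks_zero₁₂]
    exact mul_ne_zero he.det_horizontal_ne_zero he.det_vertical_ne_zero
  have hinv := inv_gramMatrix_sumElim hhv hvh he.det_horizontal_ne_zero he.det_vertical_ne_zero
  rw [← hsplit] at hinv
  have h := apply_eq_sum_inv_gramMatrix e hdet u w
  rw [hinv] at h
  simpa [hsymm _ w] using h

variable (he : IsKillingFrame U g x e) (hΓ : IsLeviCivita U g Γ) (hx : x ∈ U)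

include he hΓ hx

theorem fderiv_fderiv_vertical (u v a : E) (k : κ) :
    fderiv ℝ (fderiv ℝ fun y => g y u v) x a (e (.inr k)) = 0 := by
  have hD := differentiableAt_of_contDiffOn (contDiffOn_fderiv (hΓ.contDiffOn_apply u v) hΓ.isOpen)
    hΓ.isOpen hx
  rw [← fderiv_clm_apply_const hD,
    fderiv_congr_of_isOpen hΓ.isOpen (fun y hy => he.killing y hy k u v) hx]
  simp

theorem connection_vertical_vertical_vertical (k l m : κ) :
    g x (Γ x (e (.inr k)) (e (.inr l))) (e (.inr m)) = 0 := by
  simp [hΓ.koszul hx, he.killing x hx]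

theorem connection_vertical_vertical_horizontal (k l : κ) (i : ι) :
    g x (Γ x (e (.inr k)) (e (.inr l))) (e (.inl i))
      = -(1 / 2) * fderiv ℝ (fun y => g y (e (.inr k)) (e (.inr l))) x (e (.inl i)) := by
  rw [hΓ.koszul hx, he.killing x hx, he.killing x hx]
  ring

theorem connection_horizontal_horizontal_vertical (i j : ι) (k : κ) :
    g x (Γ x (e (.inl i)) (e (.inl j))) (e (.inr k))
      = 1 / 2 * (fderiv ℝ (fun y => g y (e (.inl j)) (e (.inr k))) x (e (.inl i))
        + fderiv ℝ (fun y => g y (e (.inl i)) (e (.inr k))) x (e (.inl j))) := by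
  rw [hΓ.koszul hx, he.killing x hx, sub_zero]

/-- Gauss' equation for the orbits, whose intrinsic metric is flat. -/
theorem metric_curvature_vertical (k l : κ) :
    g x (connectionCurvature Γ x (e (.inr k)) (e (.inr l)) (e (.inr l))) (e (.inr k))
      = 1 / 4 * ∑ i, ∑ j, (gramMatrix (g x).toLinearMap₁₂ (e ∘ Sum.inl))⁻¹ i j
        * (fderiv ℝ (fun y => g y (e (.inr k)) (e (.inr l))) x (e (.inl i))
            * fderiv ℝ (fun y => g y (e (.inr k)) (e (.inr l))) x (e (.inl j))
          - fderiv ℝ (fun y => g y (e (.inr l)) (e (.inr l))) x (e (.inl i))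
            * fderiv ℝ (fun y => g y (e (.inr k)) (e (.inr k))) x (e (.inl j))) := by
  have hflat : ∀ p q r s, g x (Γ x (e (.inr p)) (e (.inr q))) (Γ x (e (.inr r)) (e (.inr s)))
      = 1 / 4 * ∑ i, ∑ j, (gramMatrix (g x).toLinearMap₁₂ (e ∘ Sum.inl))⁻¹ i j
        * (fderiv ℝ (fun y => g y (e (.inr p)) (e (.inr q))) x (e (.inl i))
            * fderiv ℝ (fun y => g y (e (.inr r)) (e (.inr s))) x (e (.inl j))) :=
    fun p q r s => by
      rw [he.apply_eq_horizontal_add_vertical (hΓ.symm x hx)]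
      simp only [he.connection_vertical_vertical_vertical hΓ hx,
        he.connection_vertical_vertical_horizontal hΓ hx, Finset.mul_sum]
      simp only [mul_zero, Finset.sum_const_zero, add_zero]
      exact Finset.sum_congr rfl fun i _ => Finset.sum_congr rfl fun j _ => by ring
  rw [hΓ.metric_curvature hx, hΓ.torsion_free x hx (e (.inr l)) (e (.inr k)), hflat, hflat]
  simp only [he.fderiv_fderiv_vertical hΓ hx, mul_sub, Finset.sum_sub_distrib]
  ring

theorem metric_connection_horizontal {U' : Set E'} {o : E' → E' →L[ℝ] E' →L[ℝ] ℝ}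
    {Γ' : E' → E' →L[ℝ] E' →L[ℝ] E'} {x' : E'} (hΓ' : IsLeviCivita U' o Γ') (hx' : x' ∈ U')
    (e' : Basis ι ℝ E')
    (h₀ : ∀ i j, g x (e (.inl i)) (e (.inl j)) = o x' (e' i) (e' j))
    (h₁ : ∀ i j k, fderiv ℝ (fun y => g y (e (.inl j)) (e (.inl k))) x (e (.inl i))
      = fderiv ℝ (fun y => o y (e' j) (e' k)) x' (e' i)) (i j p q : ι) :
    g x (Γ x (e (.inl i)) (e (.inl j))) (Γ x (e (.inl p)) (e (.inl q)))
      = o x' (Γ' x' (e' i) (e' j)) (Γ' x' (e' p) (e' q))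
        + 1 / 4 * verticalInner g x e (shear g x e i j + shear g x e j i)
          (shear g x e p q + shear g x e q p) := by
  have hgram : gramMatrix (g x).toLinearMap₁₂ (e ∘ Sum.inl)
      = gramMatrix (o x').toLinearMap₁₂ e' := by
    ext a b
    exact h₀ a b
  have hhorizontal : ∀ a b c, g x (Γ x (e (.inl a)) (e (.inl b))) (e (.inl c))
      = o x' (Γ' x' (e' a) (e' b)) (e' c) := fun a b c => by
    rw [hΓ.koszul hx, hΓ'.koszul hx', h₁, h₁, h₁]
  have hdet : (gramMatrix (o x').toLinearMap₁₂ e').det ≠ 0 := hgram ▸ he.det_horizontal_ne_zero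
  have hquotient : ∀ u w, o x' u w = ∑ a, ∑ b, (gramMatrix (o x').toLinearMap₁₂ e')⁻¹ a b
      * (o x' u (e' a) * o x' w (e' b)) := fun u w => by
    simpa [hΓ'.symm x' hx' w] using apply_eq_sum_inv_gramMatrix e' hdet u w
  rw [he.apply_eq_horizontal_add_vertical (hΓ.symm x hx), hgram,
    hquotient (Γ' x' (e' i) (e' j))]
  simp only [hhorizontal, he.connection_horizontal_horizontal_vertical hΓ hx, verticalInner,
    Matrix.toBilin'_apply, Pi.add_apply, shear, Finset.mul_sum]
  congr 1
  exact Finset.sum_congr rfl fun k _ => Finset.sum_congr rfl fun l _ => by ring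

/-- O'Neill's formula. Here `o` is the metric of the quotient by the Killing fields, and the
hypotheses compare its derivatives with those of `g` in the given frame. -/
theorem metric_curvature_horizontal {U' : Set E'} {o : E' → E' →L[ℝ] E' →L[ℝ] ℝ}
    {Γ' : E' → E' →L[ℝ] E' →L[ℝ] E'} {x' : E'} (hΓ' : IsLeviCivita U' o Γ') (hx' : x' ∈ U')
    (e' : Basis ι ℝ E')
    (h₀ : ∀ i j, g x (e (.inl i)) (e (.inl j)) = o x' (e' i) (e' j))
    (h₁ : ∀ i j k, fderiv ℝ (fun y => g y (e (.inl j)) (e (.inl k))) x (e (.inl i))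
      = fderiv ℝ (fun y => o y (e' j) (e' k)) x' (e' i))
    (h₂ : ∀ i j p q,
      fderiv ℝ (fderiv ℝ fun y => g y (e (.inl p)) (e (.inl q))) x (e (.inl i)) (e (.inl j))
        = fderiv ℝ (fderiv ℝ fun y => o y (e' p) (e' q)) x' (e' i) (e' j)
          + verticalInner g x e (shear g x e i p) (shear g x e j q)
          + verticalInner g x e (shear g x e j p) (shear g x e i q)) (i j : ι) :
    g x (connectionCurvature Γ x (e (.inl i)) (e (.inl j)) (e (.inl j))) (e (.inl i))
      = o x' (connectionCurvature Γ' x' (e' i) (e' j) (e' j)) (e' i)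
        - 3 / 4 * verticalInner g x e (shear g x e i j - shear g x e j i)
          (shear g x e i j - shear g x e j i) := by
  have hconn := he.metric_connection_horizontal hΓ hx hΓ' hx' e' h₀ h₁
  have hcomm := verticalInner_comm e (hΓ.symm x hx)
  rw [hΓ.metric_curvature hx, hΓ'.metric_curvature hx', hconn, hconn, h₂, h₂, h₂, h₂]
  simp only [map_add, map_sub, LinearMap.add_apply, LinearMap.sub_apply]
  rw [hcomm (shear g x e j j) (shear g x e i i), hcomm (shear g x e j i) (shear g x e i j)]
  ring

end IsKillingFrame

end KillingFrame

/-! ### Metrics in adapted coordinates -/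

section AdaptedCoordinates

open Adapted Module

/-- The vector `∂/∂zᵏ`. -/
def verticalVector (k : Fin 2) : E4 := EuclideanSpace.single (Fin.natAdd 2 k) 1

/-- The constant vector field on coordinate space with the value `∂/∂tⁱ - f_i^k ∂/∂zᵏ` at `x`. -/
def horizontalVector (G : E4 → Matrix (Fin (2 + 2)) (Fin (2 + 2)) ℝ) (x : E4) (i : Fin 2) : E4 :=
  EuclideanSpace.single (Fin.castAdd 2 i) 1 - ∑ k, fUp G x i k • verticalVector k

/-- The components `∂f₂ᵏ/∂t¹ - ∂f₁ᵏ/∂t²` of the curvature of the connection given by `f_i^k`. -/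
def twist (G : E4 → Matrix (Fin (2 + 2)) (Fin (2 + 2)) ℝ) (x : E4) (k : Fin 2) : ℝ :=
  partialDeriv (Fin.castAdd 2 0) (fun y => fUp G y 1 k) x
    - partialDeriv (Fin.castAdd 2 1) (fun y => fUp G y 0 k) x

theorem join_castAdd (t z : E2) (i : Fin 2) : join t z (Fin.castAdd 2 i) = t i :=
  Fin.append_left _ _ i

theorem join_natAdd (t z : E2) (k : Fin 2) : join t z (Fin.natAdd 2 k) = z k :=
  Fin.append_right _ _ k

theorem join_eq_add (t z : E2) :
    join t z = ∑ i, t i • EuclideanSpace.single (Fin.castAdd 2 i) (1 : ℝ)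
      + ∑ k, z k • verticalVector k := by
  ext a
  refine Fin.addCases (fun i => ?_) (fun k => ?_) a
  · rw [join_castAdd]
    fin_cases i <;> simp [verticalVector, Fin.ext_iff]
  · rw [join_natAdd]
    fin_cases k <;> simp [verticalVector, Fin.ext_iff]

theorem join_tPart_zPart (x : E4) : join (tPart x) (zPart x) = x := by
  ext a
  exact Fin.addCases (join_castAdd (tPart x) (zPart x)) (join_natAdd (tPart x) (zPart x)) a

theorem contDiff_join (z : E2) : ContDiff ℝ ∞ fun t => join t z := by
  simp only [join_eq_add]
  fun_prop

theorem fderiv_join_single (t z : E2) (i : Fin 2) :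
    fderiv ℝ (fun t => join t z) t (EuclideanSpace.single i 1)
      = EuclideanSpace.single (Fin.castAdd 2 i) 1 := by
  simp only [join_eq_add, fderiv_add_const]
  have h : HasFDerivAt
      (fun t : E2 => ∑ i, t i • EuclideanSpace.single (Fin.castAdd 2 i) (1 : ℝ))
      (∑ i, (EuclideanSpace.proj i : E2 →L[ℝ] ℝ).smulRight
        (EuclideanSpace.single (Fin.castAdd 2 i) (1 : ℝ))) t :=
    HasFDerivAt.fun_sum fun i _ => (EuclideanSpace.proj i : E2 →L[ℝ] ℝ).hasFDerivAt.smul_const _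
  rw [h.fderiv]
  fin_cases i <;> simp

/-- `F` is a smooth function on `U` that does not depend on `z¹, z²`. -/
structure IsOrbitFunction (U : Set E4) (F : E4 → ℝ) : Prop where
  contDiffOn : ContDiffOn ℝ ∞ F U
  fderiv_vertical : ∀ y ∈ U, ∀ k, fderiv ℝ F y (verticalVector k) = 0

theorem isOrbitFunction_const (U : Set E4) (c : ℝ) : IsOrbitFunction U fun _ => c where
  contDiffOn := contDiffOn_const
  fderiv_vertical := by simp

namespace IsOrbitFunction

variable {U : Set E4} {F F' : E4 → ℝ} {y : E4}

theorem differentiableAt (hF : IsOrbitFunction U F) (hU : IsOpen U) (hy : y ∈ U) :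
    DifferentiableAt ℝ F y :=
  differentiableAt_of_contDiffOn hF.contDiffOn hU hy

theorem sub (hF : IsOrbitFunction U F) (hF' : IsOrbitFunction U F') (hU : IsOpen U) :
    IsOrbitFunction U fun y => F y - F' y where
  contDiffOn := hF.contDiffOn.sub hF'.contDiffOn
  fderiv_vertical y hy k := by
    rw [fderiv_fun_sub (hF.differentiableAt hU hy) (hF'.differentiableAt hU hy)]
    simp [hF.fderiv_vertical y hy, hF'.fderiv_vertical y hy]

theorem mul (hF : IsOrbitFunction U F) (hF' : IsOrbitFunction U F') (hU : IsOpen U) :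
    IsOrbitFunction U fun y => F y * F' y where
  contDiffOn := hF.contDiffOn.mul hF'.contDiffOn
  fderiv_vertical y hy k := by
    rw [fderiv_fun_mul (hF.differentiableAt hU hy) (hF'.differentiableAt hU hy)]
    simp [hF.fderiv_vertical y hy, hF'.fderiv_vertical y hy]

theorem sum {ι : Type*} {s : Finset ι} {F : ι → E4 → ℝ} (hF : ∀ i ∈ s, IsOrbitFunction U (F i))
    (hU : IsOpen U) : IsOrbitFunction U fun y => ∑ i ∈ s, F i y where
  contDiffOn := ContDiffOn.sum fun i hi => (hF i hi).contDiffOn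
  fderiv_vertical y hy k := by
    rw [fderiv_fun_sum fun i hi => (hF i hi).differentiableAt hU hy]
    simp only [sum_apply]
    exact Finset.sum_eq_zero fun i hi => (hF i hi).fderiv_vertical y hy k

theorem fderiv_apply (hF : IsOrbitFunction U F) (hU : IsOpen U) (v : E4) :
    IsOrbitFunction U fun y => fderiv ℝ F y v where
  contDiffOn := (contDiffOn_fderiv hF.contDiffOn hU).clm_apply contDiffOn_const
  fderiv_vertical y hy k := by
    have hD {z} (hz : z ∈ U) : DifferentiableAt ℝ (fderiv ℝ F) z :=
      differentiableAt_of_contDiffOn (contDiffOn_fderiv hF.contDiffOn hU) hU hz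
    rw [fderiv_clm_apply_const (hD hy), fderiv_fderiv_comm hF.contDiffOn hU hy,
      ← fderiv_clm_apply_const (hD hy),
      fderiv_congr_of_isOpen hU (fun z hz => hF.fderiv_vertical z hz k) hy]
    simp

theorem fderiv_horizontal (hF : IsOrbitFunction U F) (hy : y ∈ U)
    (G : E4 → Matrix (Fin (2 + 2)) (Fin (2 + 2)) ℝ) (x : E4) (i : Fin 2) :
    fderiv ℝ F y (horizontalVector G x i) = partialDeriv (Fin.castAdd 2 i) F y := by
  simp [horizontalVector, hF.fderiv_vertical y hy, partialDeriv]

variable {t z : E2}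

theorem fderiv_comp_join (hF : IsOrbitFunction U F) (hU : IsOpen U) (ht : join t z ∈ U)
    (G : E4 → Matrix (Fin (2 + 2)) (Fin (2 + 2)) ℝ) (x : E4) (i : Fin 2) :
    fderiv ℝ (fun s => F (join s z)) t (EuclideanSpace.single i 1)
      = fderiv ℝ F (join t z) (horizontalVector G x i) := by
  have hjoin := ((contDiff_join z).differentiable (by simp)) t
  have hcomp := fderiv_comp t (hF.differentiableAt hU ht) hjoin
  rw [hF.fderiv_horizontal ht]
  change fderiv ℝ (F ∘ fun s => join s z) t _ = _
  rw [hcomp, ContinuousLinearMap.comp_apply, fderiv_join_single, partialDeriv]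

theorem fderiv_fderiv_comp_join (hF : IsOrbitFunction U F) (hU : IsOpen U) (ht : join t z ∈ U)
    (G : E4 → Matrix (Fin (2 + 2)) (Fin (2 + 2)) ℝ) (x : E4) (i j : Fin 2) :
    fderiv ℝ (fderiv ℝ fun s => F (join s z)) t (EuclideanSpace.single i 1)
        (EuclideanSpace.single j 1)
      = fderiv ℝ (fderiv ℝ F) (join t z) (horizontalVector G x i) (horizontalVector G x j) := by
  have hV : IsOpen ((fun s => join s z) ⁻¹' U) := hU.preimage (contDiff_join z).continuous
  have hFj : ContDiffOn ℝ ∞ (fun s => F (join s z)) ((fun s => join s z) ⁻¹' U) :=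
    hF.contDiffOn.comp (contDiff_join z).contDiffOn fun _ hs => hs
  have hD := differentiableAt_of_contDiffOn (contDiffOn_fderiv hFj hV) hV ht
  rw [← fderiv_clm_apply_const hD, ← fderiv_clm_apply_const
      (differentiableAt_of_contDiffOn (contDiffOn_fderiv hF.contDiffOn hU) hU ht),
    fderiv_congr_of_isOpen hV (fun s hs => hF.fderiv_comp_join hU hs G x j) ht]
  exact (hF.fderiv_apply hU _).fderiv_comp_join hU ht G x i

end IsOrbitFunction

/-- `G` is the matrix of components on `U` of a smooth metric in adapted coordinates, where
`∂/∂z¹, ∂/∂z²` are Killing fields. -/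
structure IsAdaptedCoordMetric (U : Set E4) (G : E4 → Matrix (Fin (2 + 2)) (Fin (2 + 2)) ℝ) : Prop
    extends IsCoordMetric U G where
  det_h_ne_zero : ∀ x ∈ U, (h G x).det ≠ 0
  fderiv_vertical : ∀ a b, ∀ x ∈ U, ∀ k, fderiv ℝ (fun y => G y a b) x (verticalVector k) = 0

namespace IsAdaptedCoordMetric

variable {U : Set E4} {G : E4 → Matrix (Fin (2 + 2)) (Fin (2 + 2)) ℝ} {x y : E4}

theorem isOrbitFunction (hG : IsAdaptedCoordMetric U G) (a b : Fin (2 + 2)) :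
    IsOrbitFunction U fun y => G y a b :=
  ⟨hG.contDiffOn a b, hG.fderiv_vertical a b⟩

theorem isOrbitFunction_coordForm (hG : IsAdaptedCoordMetric U G) (u v : E4) :
    IsOrbitFunction U fun y => coordForm G y u v := by
  simp only [coordForm_apply, coordInner]
  exact .sum (fun a _ => .sum (fun b _ => ((hG.isOrbitFunction a b).mul (isOrbitFunction_const U _)
    hG.isOpen).mul (isOrbitFunction_const U _) hG.isOpen) hG.isOpen) hG.isOpen

theorem fUp_mul_h (hG : IsAdaptedCoordMetric U G) (hx : x ∈ U) : fUp G x * h G x = f G x := by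
  rw [fUp, Matrix.mul_assoc, Matrix.nonsing_inv_mul _ (hG.det_h_ne_zero x hx).isUnit,
    Matrix.mul_one]

theorem h_symm (hG : IsAdaptedCoordMetric U G) (hx : x ∈ U) (k l : Fin 2) :
    h G x k l = h G x l k :=
  hG.symm x hx _ _

theorem contDiffOn_fUp (hG : IsAdaptedCoordMetric U G) (i k : Fin 2) :
    ContDiffOn ℝ ∞ (fun y => fUp G y i k) U := by
  simp only [fUp, Matrix.mul_apply]
  exact ContDiffOn.sum fun l _ => (hG.contDiffOn _ _).mul
    (contDiffOn_matrix_inv (fun a b => hG.contDiffOn _ _) hG.det_h_ne_zero l k)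

theorem isOrbitFunction_fUp (hG : IsAdaptedCoordMetric U G) (i k : Fin 2) :
    IsOrbitFunction U fun y => fUp G y i k where
  contDiffOn := hG.contDiffOn_fUp i k
  fderiv_vertical y hy m := by
    have hh : ∀ l k, IsOrbitFunction U fun y => h G y l k := fun l k => hG.isOrbitFunction _ _
    have hfUp : ∀ l, DifferentiableAt ℝ (fun y => fUp G y i l) y := fun l =>
      differentiableAt_of_contDiffOn (hG.contDiffOn_fUp i l) hG.isOpen hy
    have hprod : ∀ l k, fderiv ℝ (fun y => fUp G y i l * h G y l k) y (verticalVector m)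
        = fderiv ℝ (fun y => fUp G y i l) y (verticalVector m) * h G y l k := fun l k => by
      rw [fderiv_fun_mul (hfUp l) ((hh l k).differentiableAt hG.isOpen hy)]
      simp [(hh l k).fderiv_vertical y hy m, mul_comm]
    have hvecMul : Matrix.vecMul
        (fun l => fderiv ℝ (fun y => fUp G y i l) y (verticalVector m)) (h G y) = 0 := by
      funext k
      have hmul : ∀ z ∈ U, ∑ l, fUp G z i l * h G z l k = f G z i k := fun z hz =>
        congrFun₂ (hG.fUp_mul_h hz) i k
      simp only [Matrix.vecMul, dotProduct, ← hprod]
      rw [← sum_apply, ← fderiv_fun_sum fun l _ => (hfUp l).fun_mul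
          ((hh l k).differentiableAt hG.isOpen hy),
        fderiv_congr_of_isOpen hG.isOpen hmul hy]
      exact (hG.isOrbitFunction _ _).fderiv_vertical y hy m
    exact congrFun (Matrix.eq_zero_of_vecMul_eq_zero (hG.det_h_ne_zero y hy) hvecMul) k

theorem isOrbitFunction_orbit (hG : IsAdaptedCoordMetric U G) (i j : Fin 2) :
    IsOrbitFunction U fun y => orbit G y i j := by
  have horbit : (fun y => orbit G y i j)
      = fun y => b G y i j - ∑ l, fUp G y i l * f G y j l := by
    funext y
    simp [orbit, fUp, Matrix.mul_apply]
  rw [horbit]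
  exact (hG.isOrbitFunction _ _).sub (.sum (fun l _ => (hG.isOrbitFunction_fUp i l).mul
    (hG.isOrbitFunction _ _) hG.isOpen) hG.isOpen) hG.isOpen

theorem orbit_symm (hG : IsAdaptedCoordMetric U G) (hx : x ∈ U) (i j : Fin 2) :
    orbit G x i j = orbit G x j i := by
  have hT : (orbit G x).transpose = orbit G x := by
    have hh : (h G x).transpose = h G x := Matrix.ext fun k l => hG.h_symm hx l k
    have hb : (b G x).transpose = b G x := Matrix.ext fun k l => hG.symm x hx _ _
    rw [orbit, Matrix.transpose_sub, Matrix.transpose_mul, Matrix.transpose_mul,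
      Matrix.transpose_nonsing_inv, Matrix.transpose_transpose, hh, hb, Matrix.mul_assoc]
  exact congrFun₂ hT j i

theorem det_orbit_ne_zero (hG : IsAdaptedCoordMetric U G) (hx : x ∈ U) :
    (orbit G x).det ≠ 0 := by
  have : Invertible (h G x) :=
    Matrix.invertibleOfIsUnitDet _ (isUnit_iff_ne_zero.2 (hG.det_h_ne_zero x hx))
  have hblocks : (G x).submatrix finSumFinEquiv finSumFinEquiv
      = Matrix.fromBlocks (b G x) (f G x) (f G x).transpose (h G x) := by
    ext (i | i) (j | j)
    · rfl
    · rfl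
    · exact hG.symm x hx _ _
    · rfl
  have hschur : (G x).det = (h G x).det * (orbit G x).det := by
    rw [← Matrix.det_submatrix_equiv_self finSumFinEquiv (G x), hblocks, Matrix.det_fromBlocks₂₂,
      Matrix.invOf_eq_nonsing_inv, orbit]
  exact right_ne_zero_of_mul (hschur ▸ hG.det_ne_zero x hx)

theorem isCoordMetric_orbit (hG : IsAdaptedCoordMetric U G) (z : E2) :
    IsCoordMetric ((fun t => join t z) ⁻¹' U) fun t => orbit G (join t z) where
  isOpen := hG.isOpen.preimage (contDiff_join z).continuous
  contDiffOn i j :=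
    (hG.isOrbitFunction_orbit i j).contDiffOn.comp (contDiff_join z).contDiffOn fun _ ht => ht
  symm _ ht := hG.orbit_symm ht
  det_ne_zero _ ht := hG.det_orbit_ne_zero ht

theorem coordForm_vertical_vertical (G : E4 → Matrix (Fin (2 + 2)) (Fin (2 + 2)) ℝ) (y : E4)
    (k l : Fin 2) : coordForm G y (verticalVector k) (verticalVector l) = h G y k l := by
  simp [coordForm, verticalVector, h]

theorem coordForm_horizontal_vertical_self (hG : IsAdaptedCoordMetric U G) (hy : y ∈ U)
    (i k : Fin 2) :
    coordForm G y (horizontalVector G y i) (verticalVector k) = 0 := by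
  have hf : coordForm G y (EuclideanSpace.single (Fin.castAdd 2 i) 1) (verticalVector k)
      = f G y i k := by
    simp [coordForm, verticalVector, f]
  have hmul : ∑ l, fUp G y i l * h G y l k = f G y i k := congrFun₂ (hG.fUp_mul_h hy) i k
  simp only [horizontalVector, map_sub, map_sum, map_smul, sub_apply,
    sum_apply, smul_apply, smul_eq_mul, hf,
    coordForm_vertical_vertical, hmul, sub_self]

theorem coordForm_horizontal_horizontal_self (hG : IsAdaptedCoordMetric U G) (hy : y ∈ U)
    (i j : Fin 2) :
    coordForm G y (horizontalVector G y i) (horizontalVector G y j) = orbit G y i j := by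
  conv_lhs => arg 2; rw [horizontalVector]
  simp only [map_sub, map_sum, map_smul, hG.coordForm_horizontal_vertical_self hy]
  simp [horizontalVector, coordForm, verticalVector, orbit, b, f, fUp, Matrix.mul_apply,
    hG.symm y hy]

theorem horizontalVector_eq_add (G : E4 → Matrix (Fin (2 + 2)) (Fin (2 + 2)) ℝ) (x y : E4)
    (i : Fin 2) : horizontalVector G x i
      = horizontalVector G y i + ∑ k, (fUp G y i k - fUp G x i k) • verticalVector k := by
  simp only [horizontalVector, sub_smul, Finset.sum_sub_distrib]
  abel

theorem coordForm_horizontal_vertical (hG : IsAdaptedCoordMetric U G) (hy : y ∈ U) (x : E4)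
    (i k : Fin 2) : coordForm G y (horizontalVector G x i) (verticalVector k)
      = ∑ l, h G y k l * (fUp G y i l - fUp G x i l) := by
  rw [horizontalVector_eq_add G x y]
  simp [hG.coordForm_horizontal_vertical_self hy, coordForm_vertical_vertical, hG.h_symm hy k,
    mul_comm]

theorem coordForm_horizontal_horizontal (hG : IsAdaptedCoordMetric U G) (hy : y ∈ U)
    (x : E4) (i j : Fin 2) : coordForm G y (horizontalVector G x i) (horizontalVector G x j)
      = orbit G y i j + ∑ l, coordForm G y (horizontalVector G x i) (verticalVector l)
        * (fUp G y j l - fUp G x j l) := by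
  have hself : coordForm G y (horizontalVector G x i) (horizontalVector G y j)
      = orbit G y i j := by
    rw [horizontalVector_eq_add G x y]
    simp [hG.coordForm_horizontal_horizontal_self hy, hG.coordForm_symm hy (verticalVector _),
      hG.coordForm_horizontal_vertical_self hy]
  conv_lhs => arg 2; rw [horizontalVector_eq_add G x y]
  rw [map_add, hself]
  simp [mul_comm]

theorem exists_isKillingFrame (hG : IsAdaptedCoordMetric U G) (hx : x ∈ U) :
    ∃ e : Basis (Fin 2 ⊕ Fin 2) ℝ E4, ⇑e = Sum.elim (horizontalVector G x) verticalVector ∧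
      IsKillingFrame U (coordForm G) x e := by
  set B := (coordForm G x).toLinearMap₁₂
  have hhorizontal : gramMatrix B (horizontalVector G x) = orbit G x :=
    Matrix.ext (hG.coordForm_horizontal_horizontal_self hx)
  have hvertical : gramMatrix B verticalVector = h G x :=
    Matrix.ext (coordForm_vertical_vertical G x)
  have horthogonal : ∀ i k, B (horizontalVector G x i) (verticalVector k) = 0 :=
    hG.coordForm_horizontal_vertical_self hx
  have hdet : (gramMatrix B (Sum.elim (horizontalVector G x) verticalVector)).det ≠ 0 := by
    rw [gramMatrix_sumElim _ _ _ horthogonal fun i k =>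
        (hG.coordForm_symm hx _ _).trans (horthogonal i k),
      Matrix.det_fromBlocks_zero₁₂, hhorizontal, hvertical]
    exact mul_ne_zero (hG.det_orbit_ne_zero hx) (hG.det_h_ne_zero x hx)
  refine ⟨basisOfLinearIndependentOfCardEqFinrank
    (linearIndependent_of_det_gramMatrix_ne_zero hdet) (by simp), by simp, ?_⟩
  exact
    { killing := fun y hy k u v => by
        simpa using (hG.isOrbitFunction_coordForm u v).fderiv_vertical y hy k
      orthogonal := fun i k => by simpa using hG.coordForm_horizontal_vertical_self hx i k
      det_horizontal_ne_zero := by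
        simpa [Function.comp_def] using hhorizontal ▸ hG.det_orbit_ne_zero hx
      det_vertical_ne_zero := by
        simpa [Function.comp_def] using hvertical ▸ hG.det_h_ne_zero x hx }

theorem contDiffOn_fUp_sub (hG : IsAdaptedCoordMetric U G) (x : E4) (i k : Fin 2) :
    ContDiffOn ℝ ∞ (fun y => fUp G y i k - fUp G x i k) U :=
  (hG.contDiffOn_fUp i k).sub contDiffOn_const

theorem fderiv_horizontal_vertical (hG : IsAdaptedCoordMetric U G) (hx : x ∈ U) (j k : Fin 2) :
    fderiv ℝ (fun y => coordForm G y (horizontalVector G x j) (verticalVector k)) x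
      = ∑ l, h G x k l • fderiv ℝ (fun y => fUp G y j l) x := by
  rw [fderiv_congr_of_isOpen hG.isOpen (fun y hy => hG.coordForm_horizontal_vertical hy x j k) hx]
  simpa [fderiv_sub_const] using fderiv_add_sum_mul (f := fun _ => 0) (p := fun l y => h G y k l)
    contDiffOn_const (fun l => hG.contDiffOn _ _) (hG.contDiffOn_fUp_sub x j) hG.isOpen hx

theorem fderiv_horizontal_horizontal (hG : IsAdaptedCoordMetric U G) (hx : x ∈ U) (i j : Fin 2) :
    fderiv ℝ (fun y => coordForm G y (horizontalVector G x i) (horizontalVector G x j)) x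
      = fderiv ℝ (fun y => orbit G y i j) x := by
  rw [fderiv_congr_of_isOpen hG.isOpen (fun y hy => hG.coordForm_horizontal_horizontal hy x i j) hx,
    fderiv_add_sum_mul (hG.isOrbitFunction_orbit i j).contDiffOn
      (fun l => (hG.isOrbitFunction_coordForm _ _).contDiffOn) (hG.contDiffOn_fUp_sub x j)
      hG.isOpen hx]
  simp [hG.coordForm_horizontal_vertical_self hx]

theorem fderiv_fderiv_horizontal_horizontal (hG : IsAdaptedCoordMetric U G) (hx : x ∈ U)
    (i j : Fin 2) (a c : E4) :
    fderiv ℝ (fderiv ℝ fun y => coordForm G y (horizontalVector G x i) (horizontalVector G x j))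
        x a c
      = fderiv ℝ (fderiv ℝ fun y => orbit G y i j) x a c
        + ∑ k, (fderiv ℝ (fun y => coordForm G y (horizontalVector G x i) (verticalVector k)) x a
              * fderiv ℝ (fun y => fUp G y j k) x c
            + fderiv ℝ (fun y => coordForm G y (horizontalVector G x i) (verticalVector k)) x c
              * fderiv ℝ (fun y => fUp G y j k) x a) := by
  have hcongr : Set.EqOn
      (fderiv ℝ fun y => coordForm G y (horizontalVector G x i) (horizontalVector G x j)) _ U :=
    fun z hz => fderiv_congr_of_isOpen hG.isOpen
      (fun y hy => hG.coordForm_horizontal_horizontal hy x i j) hz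
  rw [fderiv_congr_of_isOpen hG.isOpen hcongr hx,
    fderiv_fderiv_add_sum_mul (hG.isOrbitFunction_orbit i j).contDiffOn
      (fun l => (hG.isOrbitFunction_coordForm _ _).contDiffOn) (hG.contDiffOn_fUp_sub x j)
      hG.isOpen hx (hG.coordForm_horizontal_vertical_self hx i) (fun k => sub_self _)]
  simp only [fderiv_sub_const]

section Frame

variable {e : Basis (Fin 2 ⊕ Fin 2) ℝ E4}

theorem shear_eq_mulVec (hG : IsAdaptedCoordMetric U G) (hx : x ∈ U)
    (he : ⇑e = Sum.elim (horizontalVector G x) verticalVector) (i j : Fin 2) :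
    shear (coordForm G) x e i j = (h G x).mulVec fun k =>
      partialDeriv (Fin.castAdd 2 i) (fun y => fUp G y j k) x := by
  funext k
  simp [shear, he, hG.fderiv_horizontal_vertical hx, Matrix.mulVec, dotProduct,
    (hG.isOrbitFunction_fUp j _).fderiv_horizontal hx]

theorem verticalInner_mulVec (hG : IsAdaptedCoordMetric U G) (hx : x ∈ U)
    (he : ⇑e = Sum.elim (horizontalVector G x) verticalVector)
    (u w : Fin 2 → ℝ) :
    verticalInner (coordForm G) x e u ((h G x).mulVec w) = u ⬝ᵥ w := by
  have hgram : gramMatrix (coordForm G x).toLinearMap₁₂ (e ∘ Sum.inr) = h G x := by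
    rw [he]
    exact Matrix.ext (coordForm_vertical_vertical G x)
  rw [verticalInner, hgram, Matrix.toBilin'_apply', Matrix.mulVec_mulVec,
    Matrix.nonsing_inv_mul _ (hG.det_h_ne_zero x hx).isUnit, Matrix.one_mulVec]

theorem fderiv_fderiv_horizontal_horizontal_eq_add_verticalInner (hG : IsAdaptedCoordMetric U G)
    (hx : x ∈ U) (he : ⇑e = Sum.elim (horizontalVector G x) verticalVector) (i j p q : Fin 2) :
    fderiv ℝ (fderiv ℝ fun y => coordForm G y (e (.inl p)) (e (.inl q))) x (e (.inl i))
        (e (.inl j))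
      = fderiv ℝ (fderiv ℝ fun y => orbit G y p q) x (horizontalVector G x i)
          (horizontalVector G x j)
        + verticalInner (coordForm G) x e (shear (coordForm G) x e i p)
          (shear (coordForm G) x e j q)
        + verticalInner (coordForm G) x e (shear (coordForm G) x e j p)
          (shear (coordForm G) x e i q) := by
  rw [hG.shear_eq_mulVec hx he j q, hG.shear_eq_mulVec hx he i q, hG.verticalInner_mulVec hx he,
    hG.verticalInner_mulVec hx he]
  simp only [he, Sum.elim_inl, hG.fderiv_fderiv_horizontal_horizontal hx, dotProduct, shear,
    Sum.elim_inr, (hG.isOrbitFunction_fUp q _).fderiv_horizontal hx, Finset.sum_add_distrib,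
    add_assoc]

end Frame

theorem coordSectional_vertical (hG : IsAdaptedCoordMetric U G) (hx : x ∈ U) :
    coordSectional G x (verticalVector 0) (verticalVector 1) = -(1 / 4) * Cchi G x := by
  obtain ⟨e, he, hframe⟩ := hG.exists_isKillingFrame hx
  have hgram : gramMatrix (coordForm G x).toLinearMap₁₂ (e ∘ Sum.inl) = orbit G x := by
    rw [he]
    exact Matrix.ext (hG.coordForm_horizontal_horizontal_self hx)
  have hinv : (orbit G x)⁻¹ 1 0 = (orbit G x)⁻¹ 0 1 := by
    simp [Matrix.inv_def, Matrix.adjugate_fin_two, hG.orbit_symm hx 1 0]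
  have hh : (h G x).det = h G x 0 0 * h G x 1 1 - h G x 0 1 ^ 2 := by
    rw [Matrix.det_fin_two, hG.h_symm hx 1 0, sq]
  have hD : ∀ i k l, fderiv ℝ (fun y => coordForm G y (verticalVector k) (verticalVector l)) x
      (horizontalVector G x i) = partialDeriv (Fin.castAdd 2 i) (fun y => h G y k l) x :=
    fun i k l => by
      simp only [coordForm_vertical_vertical]
      exact (hG.isOrbitFunction _ _).fderiv_horizontal hx G x i
  have hgauss := hframe.metric_curvature_vertical hG.isLeviCivita hx 0 1
  simp only [he, Sum.elim_inl, Sum.elim_inr] at hgauss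
  rw [← he, hgram] at hgauss
  simp only [hD] at hgauss
  rw [coordSectional, ← coordForm_apply, hG.curvatureOp_eq_connectionCurvature hx, hgauss,
    ← coordForm_apply, ← coordForm_apply, ← coordForm_apply]
  simp only [coordForm_vertical_vertical, ← hh, Cchi, chi, Matrix.of_apply, Fin.sum_univ_two, hinv]
  have := hG.det_h_ne_zero x hx
  field_simp
  ring

theorem sign_mul_ellC (hG : IsAdaptedCoordMetric U G) (hx : x ∈ U) :
    Real.sign (orbit G x).det * ellC G x
      = (h G x).mulVec (twist G x) ⬝ᵥ twist G x / (orbit G x).det := by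
  have hsq : √|(orbit G x).det| * √|(orbit G x).det| = |(orbit G x).det| :=
    Real.mul_self_sqrt (abs_nonneg _)
  have hsign : Real.sign (orbit G x).det * |(orbit G x).det|⁻¹ = (orbit G x).det⁻¹ := by
    rcases lt_or_gt_of_ne (hG.det_orbit_ne_zero hx) with hneg | hpos
    · rw [Real.sign_of_neg hneg, abs_of_neg hneg, inv_neg, neg_one_mul, neg_neg]
    · rw [Real.sign_of_pos hpos, abs_of_pos hpos, one_mul]
  rw [div_eq_mul_inv, ← hsign, ← hsq, mul_inv]
  simp only [ellC, curvVector, twist, Matrix.mulVec, dotProduct, Fin.sum_univ_two, div_eq_mul_inv]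
  ring

theorem det_orbit_eq (hG : IsAdaptedCoordMetric U G) (hx : x ∈ U) :
    (orbit G x).det = orbit G x 0 0 * orbit G x 1 1 - orbit G x 0 1 ^ 2 := by
  rw [Matrix.det_fin_two, hG.orbit_symm hx 1 0, sq]

theorem Cric_eq (hG : IsAdaptedCoordMetric U G) (hx : x ∈ U) :
    Cric G x = 2 * (coordForm (fun t => orbit G (join t (zPart x))) (tPart x)
      (connectionCurvature (christoffelMap fun t => orbit G (join t (zPart x))) (tPart x)
        (coordBasis 2 0) (coordBasis 2 1) (coordBasis 2 1)) (coordBasis 2 0)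
      / (orbit G x).det) := by
  have hO := hG.isCoordMetric_orbit (zPart x)
  have ht : tPart x ∈ (fun t => join t (zPart x)) ⁻¹' U := by
    rwa [Set.mem_preimage, join_tPart_zPart]
  rw [Cric, hO.scalarCurvature_fin_two ht, coordSectional, hG.det_orbit_eq hx,
    hO.curvatureOp_eq_connectionCurvature ht]
  simp [← coordForm_apply, coordForm, join_tPart_zPart]

theorem metric_curvature_horizontal (hG : IsAdaptedCoordMetric U G) (hx : x ∈ U) :
    coordForm G x (connectionCurvature (christoffelMap G) x (horizontalVector G x 0)
        (horizontalVector G x 1) (horizontalVector G x 1)) (horizontalVector G x 0)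
      = coordForm (fun t => orbit G (join t (zPart x))) (tPart x)
          (connectionCurvature (christoffelMap fun t => orbit G (join t (zPart x))) (tPart x)
            (coordBasis 2 0) (coordBasis 2 1) (coordBasis 2 1)) (coordBasis 2 0)
        - 3 / 4 * ((h G x).mulVec (twist G x) ⬝ᵥ twist G x) := by
  obtain ⟨e, he, hframe⟩ := hG.exists_isKillingFrame hx
  have hO := hG.isCoordMetric_orbit (zPart x)
  have hxtz := join_tPart_zPart x
  have ht : join (tPart x) (zPart x) ∈ U := hxtz.symm ▸ hx
  have hbasis : ∀ i j, (fun t => coordForm (fun t => orbit G (join t (zPart x))) t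
      (coordBasis 2 i) (coordBasis 2 j)) = fun t => orbit G (join t (zPart x)) i j :=
    fun i j => funext fun t => by simp [coordForm]
  have htwist : shear (coordForm G) x e 0 1 - shear (coordForm G) x e 1 0
      = (h G x).mulVec (twist G x) := by
    rw [hG.shear_eq_mulVec hx he, hG.shear_eq_mulVec hx he, ← Matrix.mulVec_sub]
    rfl
  have honeill := hframe.metric_curvature_horizontal hG.isLeviCivita hx hO.isLeviCivita ht
    (coordBasis 2)
    (fun i j => by
      rw [congrFun (hbasis i j), hxtz, he]
      exact hG.coordForm_horizontal_horizontal_self hx i j)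
    (fun i j k => by
      have hcomp := (hG.isOrbitFunction_orbit j k).fderiv_comp_join hG.isOpen ht G x i
      rw [hbasis, coordBasis_apply, hcomp, hxtz, he]
      exact DFunLike.congr_fun (hG.fderiv_horizontal_horizontal hx j k) _)
    (fun i j p q => by
      have hcomp := (hG.isOrbitFunction_orbit p q).fderiv_fderiv_comp_join hG.isOpen ht G x i j
      rw [hbasis, coordBasis_apply, coordBasis_apply, hcomp, hxtz]
      exact hG.fderiv_fderiv_horizontal_horizontal_eq_add_verticalInner hx he i j p q) 0 1
  rw [htwist, hG.verticalInner_mulVec hx he] at honeill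
  simpa only [he, Sum.elim_inl] using honeill

theorem coordSectional_horizontal (hG : IsAdaptedCoordMetric U G) (hx : x ∈ U) :
    coordSectional G x (horizontalVector G x 0) (horizontalVector G x 1)
      = 1 / 2 * Cric G x - Real.sign (orbit G x).det * (3 / 4) * ellC G x := by
  rw [coordSectional, ← coordForm_apply, hG.curvatureOp_eq_connectionCurvature hx,
    hG.metric_curvature_horizontal hx, mul_right_comm, hG.sign_mul_ellC hx, hG.Cric_eq hx]
  simp only [← coordForm_apply, hG.coordForm_horizontal_horizontal_self hx, ← hG.det_orbit_eq hx]
  ring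

end IsAdaptedCoordMetric

end AdaptedCoordinates

/-! ### Einstein metrics in coordinates -/

section Einstein

open Adapted Module

theorem IsCoordMetric.coordSectional_eq_of_einstein {n : ℕ}
    {G : Coords n → Matrix (Fin n) (Fin n) ℝ} {U : Set (Coords n)} {x : Coords n}
    (hG : IsCoordMetric U G) (hx : x ∈ U) {Λ : ℝ} (hΛ : ∀ j k, ricci G j k x = Λ * G x j k)
    {u w : Fin 2 → Coords n} (e : Basis (Fin 2 ⊕ Fin 2) ℝ (Coords n)) (he : ⇑e = Sum.elim u w)
    (huw : ∀ i k, coordForm G x (u i) (w k) = 0) :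
    coordSectional G x (u 0) (u 1) = coordSectional G x (w 0) (w 1) := by
  have hwu : ∀ i k, coordForm G x (w k) (u i) = 0 := fun i k =>
    (hG.coordForm_symm hx _ _).trans (huw i k)
  have hdet := (nondegenerate_iff_det_gramMatrix_ne_zero e).1 (hG.nondegenerate_coordBilin hx)
  rw [he, gramMatrix_sumElim (coordBilin G x) u w huw hwu, Matrix.det_fromBlocks_zero₁₂] at hdet
  have hric := hG.partialRicci_of_einstein hx hΛ e
  rw [he] at hric
  rw [coordSectional_eq_sectionalCurvature, coordSectional_eq_sectionalCurvature]
  exact (hG.isCurvatureOperator hx).sectionalCurvature_eq_of_einstein huw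
    (left_ne_zero_of_mul hdet) (right_ne_zero_of_mul hdet) hric

theorem IsAdaptedCoordMetric.Cric_add_Cchi_sub_ellC
    {G : E4 → Matrix (Fin (2 + 2)) (Fin (2 + 2)) ℝ} {U : Set E4} {x : E4}
    (hG : IsAdaptedCoordMetric U G) (hx : x ∈ U) {Λ : ℝ}
    (hΛ : ∀ j k, ricci G j k x = Λ * G x j k) :
    Cric G x + 1 / 2 * Cchi G x - Real.sign (orbit G x).det * (3 / 2) * ellC G x = 0 := by
  obtain ⟨e, he, -⟩ := hG.exists_isKillingFrame hx
  have heinstein := hG.coordSectional_eq_of_einstein hx hΛ e he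
    (hG.coordForm_horizontal_vertical_self hx)
  rw [hG.coordSectional_horizontal hx, hG.coordSectional_vertical hx] at heinstein
  linear_combination 2 * heinstein

end Einstein

/-! ### Passing from the manifold to coordinates -/

section Charts

open Module

variable {M : Type*} [TopologicalSpace M] [ChartedSpace E4 M]
  {φ : OpenPartialHomeomorph M E4} {p : M}

theorem exists_coordComponents_equiv (hφ : φ ∈ IsManifold.maximalAtlas 𝓘(ℝ, E4) ∞ M)
    (hp : p ∈ φ.source) :
    ∃ L : TangentSpace 𝓘(ℝ, E4) p ≃ₗ[ℝ] E4, (∀ v, coordComponents φ p v = L v) ∧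
      ∀ a, coordVector φ p a = L.symm (coordBasis (2 + 2) a) := by
  have hφ₁ : φ ∈ IsManifold.maximalAtlas 𝓘(ℝ, E4) 1 M :=
    IsManifold.maximalAtlas_subset_of_le (by simp) hφ
  have hd : φ.MDifferentiable 𝓘(ℝ, E4) 𝓘(ℝ, E4) :=
    ⟨fun q hq => (mdifferentiableAt_of_mem_maximalAtlas hφ₁ hq).mdifferentiableWithinAt,
      fun q hq => (mdifferentiableAt_symm_of_mem_maximalAtlas hφ₁ hq).mdifferentiableWithinAt⟩
  refine ⟨(hd.mfderiv hp).toLinearEquiv, fun v => rfl, fun a => ?_⟩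
  have hcoe : mfderiv 𝓘(ℝ, E4) 𝓘(ℝ, E4) φ p
      = (hd.mfderiv hp : TangentSpace 𝓘(ℝ, E4) p →L[ℝ] TangentSpace 𝓘(ℝ, E4) (φ p)) := rfl
  rw [coordVector, hcoe, ContinuousLinearMap.inverse_equiv, coordBasis_apply]
  rfl

theorem coordComponents_coordVector (hφ : φ ∈ IsManifold.maximalAtlas 𝓘(ℝ, E4) ∞ M)
    (hp : p ∈ φ.source) (a : Fin (2 + 2)) :
    coordComponents φ p (coordVector φ p a) = EuclideanSpace.single a 1 := by
  obtain ⟨L, hL, hvector⟩ := exists_coordComponents_equiv hφ hp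
  rw [hL, hvector, LinearEquiv.apply_symm_apply, coordBasis_apply]

theorem coordComponents_horizontalFrame (g : PseudoRiemannianMetric M)
    (hφ : φ ∈ IsManifold.maximalAtlas 𝓘(ℝ, E4) ∞ M) (hp : p ∈ φ.source) (i : Fin 2) :
    coordComponents φ p (horizontalFrame g φ p i)
      = horizontalVector (g.components φ) (φ p) i := by
  obtain ⟨L, hL, hvector⟩ := exists_coordComponents_equiv hφ hp
  simp only [hL, horizontalFrame, horizontalVector, verticalVector, map_sub, map_sum, map_smul,
    hvector, LinearEquiv.apply_symm_apply, coordBasis_apply]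

theorem disjoint_killingDistribution_orthogonalDistribution {g : PseudoRiemannianMetric M}
    {ξ : Fin 2 → ∀ p : M, TangentSpace 𝓘(ℝ, E4) p}
    (hξ : (gramMatrix (g.val p) fun k => ξ k p).det ≠ 0) :
    Disjoint (killingDistribution ξ p) (orthogonalDistribution g ξ p) := by
  rw [Submodule.disjoint_def]
  intro v hv hv'
  obtain ⟨c, rfl⟩ := (Submodule.mem_span_range_iff_exists_fun ℝ).1 hv
  have hc : (gramMatrix (g.val p) fun k => ξ k p).mulVec c = 0 := by
    funext l
    have horth := LinearMap.BilinForm.mem_orthogonal_iff.1 hv' (ξ l p)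
      (Submodule.subset_span ⟨l, rfl⟩)
    rw [map_sum] at horth
    simpa [gramMatrix, Matrix.mulVec, dotProduct, mul_comm] using horth
  simp [Matrix.eq_zero_of_mulVec_eq_zero hξ hc]

namespace PseudoRiemannianMetric

variable {g : PseudoRiemannianMetric M}

theorem val_eq_coordForm (g : PseudoRiemannianMetric M)
    (hφ : φ ∈ IsManifold.maximalAtlas 𝓘(ℝ, E4) ∞ M) (hp : p ∈ φ.source)
    (u v : TangentSpace 𝓘(ℝ, E4) p) :
    g.val p u v
      = coordForm (g.components φ) (φ p) (coordComponents φ p u) (coordComponents φ p v) := by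
  obtain ⟨L, hL, hvector⟩ := exists_coordComponents_equiv hφ hp
  have hforms : (g.val p).compl₁₂ L.symm.toLinearMap L.symm.toLinearMap
      = coordBilin (g.components φ) (φ p) := by
    refine (coordBasis (2 + 2)).ext fun a => (coordBasis (2 + 2)).ext fun b => ?_
    have hgram : coordBilin (g.components φ) (φ p) (coordBasis (2 + 2) a) (coordBasis (2 + 2) b)
        = g.components φ (φ p) a b := congrFun₂ (gramMatrix_coordBasis (φ p)) a b
    rw [hgram, components, Matrix.of_apply, φ.left_inv hp, hvector, hvector]
    rfl
  simpa [hL] using LinearMap.congr_fun₂ hforms (L u) (L v)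

theorem isCoordMetric (g : PseudoRiemannianMetric M)
    (hφ : φ ∈ IsManifold.maximalAtlas 𝓘(ℝ, E4) ∞ M) :
    IsCoordMetric φ.target (g.components φ) where
  isOpen := φ.open_target
  contDiffOn := g.smooth φ hφ
  symm _ _ _ _ := g.symm _ _ _
  det_ne_zero x hx := by
    obtain ⟨L, -, hvector⟩ := exists_coordComponents_equiv hφ (φ.map_target hx)
    have hgram : gramMatrix (g.val (φ.symm x)) ((coordBasis (2 + 2)).map L.symm)
        = g.components φ x := by
      ext a b
      simp [gramMatrix, components, hvector]
    rw [← hgram, ← nondegenerate_iff_det_gramMatrix_ne_zero]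
    have hrefl : (g.val (φ.symm x)).IsRefl := fun u v h => (g.symm _ v u).trans h
    exact hrefl.nondegenerate_iff_separatingLeft.2 (g.nondegenerate _)

theorem sectional_eq_of_isLambdaVacuum {Λ : ℝ}
    (hΛ : g.IsLambdaVacuum Λ) (hφ : φ ∈ IsManifold.maximalAtlas 𝓘(ℝ, E4) ∞ M)
    (hp : p ∈ φ.source) {u w : Fin 2 → TangentSpace 𝓘(ℝ, E4) p}
    (huw : LinearIndependent ℝ (Sum.elim u w)) (horth : ∀ i k, g.val p (u i) (w k) = 0) :
    g.sectional φ p (u 0) (u 1) = g.sectional φ p (w 0) (w 1) := by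
  obtain ⟨L, hL, -⟩ := exists_coordComponents_equiv hφ hp
  have hx := φ.map_source hp
  let e : Basis (Fin 2 ⊕ Fin 2) ℝ E4 := basisOfLinearIndependentOfCardEqFinrank
    (huw.map' L.toLinearMap L.ker) (by simp)
  refine (g.isCoordMetric hφ).coordSectional_eq_of_einstein hx
    (fun j k => sub_eq_zero.1 (hΛ φ hφ _ hx j k)) (u := fun i => coordComponents φ p (u i))
    (w := fun k => coordComponents φ p (w k)) e ?_ fun i k => ?_
  · simp only [e, coe_basisOfLinearIndependentOfCardEqFinrank, hL]
    exact Sum.comp_elim _ _ _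
  · rw [← g.val_eq_coordForm hφ hp, horth]

variable [IsManifold 𝓘(ℝ, E4) ∞ M] {ξ : Fin 2 → ∀ p : M, TangentSpace 𝓘(ℝ, E4) p}

theorem isAdaptedCoordMetric
    (hξ : ∀ p, (gramMatrix (g.val p) fun k => ξ k p).det ≠ 0) (hkilling : ∀ k, g.IsKilling (ξ k))
    (hφ : IsAdapted ξ φ) : IsAdaptedCoordMetric φ.target (g.components φ) where
  toIsCoordMetric := g.isCoordMetric hφ.1
  det_h_ne_zero x hx := by
    have hdet := hξ (φ.symm x)
    simp only [hφ.2 _ (φ.map_target hx)] at hdet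
    exact hdet
  fderiv_vertical a b x hx k := by
    have hconst : ∀ y ∈ φ.target, coordComponents φ (φ.symm y) (ξ k (φ.symm y))
        = EuclideanSpace.single (Fin.natAdd 2 k) 1 := fun y hy => by
      rw [hφ.2 _ (φ.map_target hy), coordComponents_coordVector hφ.1 (φ.map_target hy)]
    have hderiv : ∀ a c, partialDeriv a
        (fun y => coordComponents φ (φ.symm y) (ξ k (φ.symm y)) c) x = 0 := fun a c => by
      rw [partialDeriv, fderiv_congr_of_isOpen φ.open_target
        (fun y hy => congrArg (fun v : E4 => v c) (hconst y hy)) hx]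
      simp
    have hk := hkilling k φ hφ.1 x hx a b
    simp only [hderiv, hconst x hx, zero_mul, add_zero, PiLp.single_apply, ite_mul, one_mul,
      Finset.sum_ite_eq', Finset.mem_univ, if_true] at hk
    exact hk

end PseudoRiemannianMetric

end Charts

end

theorem mainTheorem12_general {M : Type*} [TopologicalSpace M] [ChartedSpace E4 M]
    [IsManifold 𝓘(ℝ, E4) ∞ M] (g : PseudoRiemannianMetric M)
    (ξ : Fin 2 → ∀ p : M, TangentSpace 𝓘(ℝ, E4) p)
    (hξ : ∀ p, (Matrix.of fun k l => g.val p (ξ k p) (ξ l p)).det ≠ 0) :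
    (∀ Λ, g.IsLambdaVacuum Λ → ∀ φ ∈ IsManifold.maximalAtlas 𝓘(ℝ, E4) ∞ M, ∀ p ∈ φ.source,
      ∀ u w : Fin 2 → TangentSpace 𝓘(ℝ, E4) p,
        LinearIndependent ℝ u → (∀ i, u i ∈ killingDistribution ξ p) →
        LinearIndependent ℝ w → (∀ i, w i ∈ orthogonalDistribution g ξ p) →
        g.sectional φ p (u 0) (u 1) = g.sectional φ p (w 0) (w 1)) ∧
    ((∀ k, g.IsKilling (ξ k)) → ∀ φ, IsAdapted ξ φ → ∀ p ∈ φ.source,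
      g.sectional φ p (coordVector φ p (Fin.natAdd 2 0)) (coordVector φ p (Fin.natAdd 2 1))
          = -(1 / 4) * Adapted.Cchi (g.components φ) (φ p) ∧
      g.sectional φ p (horizontalFrame g φ p 0) (horizontalFrame g φ p 1)
          = (1 / 2) * Adapted.Cric (g.components φ) (φ p)
            - Real.sign (Adapted.orbit (g.components φ) (φ p)).det * (3 / 4)
              * Adapted.ellC (g.components φ) (φ p) ∧
      ∀ Λ, g.IsLambdaVacuum Λ →
        Adapted.Cric (g.components φ) (φ p) + (1 / 2) * Adapted.Cchi (g.components φ) (φ p)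
          - Real.sign (Adapted.orbit (g.components φ) (φ p)).det * (3 / 2)
            * Adapted.ellC (g.components φ) (φ p) = 0) := by
  refine ⟨fun Λ hΛ φ hφ p hp u w hu hu' hw hw' => ?_, fun hkilling φ hφ p hp => ?_⟩
  · have hdisjoint : Disjoint (Submodule.span ℝ (Set.range u)) (Submodule.span ℝ (Set.range w)) :=
      (disjoint_killingDistribution_orthogonalDistribution (hξ p)).mono
        (Submodule.span_le.2 (Set.range_subset_iff.2 hu'))
        (Submodule.span_le.2 (Set.range_subset_iff.2 hw'))
    exact g.sectional_eq_of_isLambdaVacuum hΛ hφ hp (hu.sum_type hw hdisjoint) fun i k =>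
      LinearMap.BilinForm.mem_orthogonal_iff.1 (hw' k) _ (hu' i)
  · have hG := g.isAdaptedCoordMetric hξ hkilling hφ
    have hx := φ.map_source hp
    refine ⟨?_, ?_, fun Λ hΛ => hG.Cric_add_Cchi_sub_ellC hx fun j k =>
      sub_eq_zero.1 (hΛ φ hφ.1 _ hx j k)⟩
    · simp only [PseudoRiemannianMetric.sectional, coordComponents_coordVector hφ.1 hp]
      exact hG.coordSectional_vertical hx
    · simp only [PseudoRiemannianMetric.sectional, coordComponents_horizontalFrame g hφ.1 hp]
      exact hG.coordSectional_horizontal hx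

theorem mainTheorem12 {M : Type*} [TopologicalSpace M] [ChartedSpace E4 M]
    [IsManifold 𝓘(ℝ, E4) ∞ M] (g : PseudoRiemannianMetric M)
    (ξ : Fin 2 → ∀ p : M, TangentSpace 𝓘(ℝ, E4) p) (hg : IsG2Metric g ξ)
    (Λ : ℝ) (hΛ : g.IsLambdaVacuum Λ) :
    (∀ φ ∈ IsManifold.maximalAtlas 𝓘(ℝ, E4) ∞ M, ∀ p ∈ φ.source,
      ∀ u w : Fin 2 → TangentSpace 𝓘(ℝ, E4) p,
        LinearIndependent ℝ u → (∀ i, u i ∈ killingDistribution ξ p) →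
        LinearIndependent ℝ w → (∀ i, w i ∈ orthogonalDistribution g ξ p) →
        g.sectional φ p (u 0) (u 1) = g.sectional φ p (w 0) (w 1)) ∧
    (∀ φ, IsAdapted ξ φ → ∀ p ∈ φ.source,
      g.sectional φ p (coordVector φ p (Fin.natAdd 2 0)) (coordVector φ p (Fin.natAdd 2 1))
          = -(1 / 4) * Adapted.Cchi (g.components φ) (φ p) ∧
      g.sectional φ p (horizontalFrame g φ p 0) (horizontalFrame g φ p 1)
          = (1 / 2) * Adapted.Cric (g.components φ) (φ p)
            - Real.sign (Adapted.orbit (g.components φ) (φ p)).det * (3 / 4)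
              * Adapted.ellC (g.components φ) (φ p) ∧
      Adapted.Cric (g.components φ) (φ p) + (1 / 2) * Adapted.Cchi (g.components φ) (φ p)
          - Real.sign (Adapted.orbit (g.components φ) (φ p)).det * (3 / 2)
            * Adapted.ellC (g.components φ) (φ p) = 0) := by
  obtain ⟨hK, hadapted⟩ := mainTheorem12_general g ξ hg.nonnull
  exact ⟨hK Λ hΛ, fun φ hφ p hp => (hadapted hg.killing φ hφ p hp).imp_right
    (And.imp_right fun hsum => hsum Λ hΛ)⟩
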